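/- **Theorem 1.3.** A *subtree* of a tree $T$ is a non-empty connected induced subgraph of $T$; let $F(T)$ be the number of subtrees of $T$. Let $q\ge p\ge 1$ and $n=p+q$, and let $\mathscr P_n^{p,q}$ be the set of $n$-vertex trees (up to isomorphism) whose vertex set can be partitioned into sets of sizes $p$ and $q$ such that each edge joins the two sets. Let $D(p,q)$ be the tree obtained from the star $K_{1,p}$ by attaching $q-1$ pendant edges to one non-central vertex. For $q\ge p\ge 3$, let $B(p,q)$ be the tree obtained from $D(p-1,q)$ by attaching a pendant edge to a vertex of degree one adjacent to the vertex of degree $q$; for $q\ge 2$, let $B(2,q)$ be obtained from the path $P_4$ by attaching $q-2$ pendant edges to an end vertex. For $k\ge 1$, let $P_k(a,b)$ be the tree obtained from the path $P_k$ by attaching $a$ pendant vertices to one end vertex and $b$ to the other (so $P_1(a,b)=K_{1,a+b}$). Then: (i) $D(p,q)$ is the unique tree maximizing $F$ over $\mathscr P_n^{p,q}$, and $$F(D(p,q))=2^{n-2}+2^{p-1}+2^{q-1}+n-2.$$ (ii) If $p\ge 2$, then $B(p,q)\in\mathscr P_n^{p,q}$ and $$F(B(p,q))=\begin{cases}3\cdot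 2^{n-4}+3\cdot 2^{q-2}+2^{p-2}+n-1,& p>2,\\ 2^{n-2}+n+2,& p=2.\end{cases}$$ If moreover $(p,q)\ne(2,2)$, then $B(p,q)\not\cong D(p,q)$ and $B(p,q)$ is the unique tree maximizing $F$ over $\mathscr P_n^{p,q}\setminus\{D(p,q)\}$. (For $p=q=2$ this set is empty.) (iii) $P_{2p-1}\left(\lfloor\frac{n-2p+1}{2}\rfloor,\lceil\frac{n-2p+1}{2}\rceil\right)$ is the unique tree minimizing $F$ over $\mathscr P_n^{p,q}$, and its number of subtrees is $$(2p-2)\left(2^{\lfloor\frac{n-2p+1}{2}\rfloor}+2^{\lceil\frac{n-2p+1}{2}\rceil}\right)+\binom{2p-2}{2}+2^{n-2p+1}+n-2p+1.$$ -/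

import Mathlib

/-- The number of subtrees of `T`: the number of non-empty connected induced subgraphs of `T`.
An induced subgraph is determined by its vertex set, and `Connected` includes non-emptiness. -/
noncomputable def subtreeCount {V : Type*} (T : SimpleGraph V) : ℕ :=
  {S : Set V | (T.induce S).Connected}.ncard

/-- `T` is a tree with `n` vertices that has a `(p, q)`-bipartition. -/
structure IsBipartitionTree (n p q : ℕ) {V : Type*} (T : SimpleGraph V) : Prop where
  isTree : T.IsTree
  card_eq : Nat.card V = n
  bipartition : ∃ V₁ V₂ : Set V, V₁ ∪ V₂ = Set.univ ∧ T.IsBipartiteWith V₁ V₂ ∧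
    V₁.ncard = p ∧ V₂.ncard = q

/-- The graph obtained from `G` by attaching `m` pendant edges (hence `m` new vertices of
degree one, namely `Sum.inr i` for `i : Fin m`) to the vertex `v`. -/
def attachPendants {V : Type*} (G : SimpleGraph V) (v : V) (m : ℕ) :
    SimpleGraph (V ⊕ Fin m) where
  Adj
    | Sum.inl a, Sum.inl b => G.Adj a b
    | Sum.inl a, Sum.inr _ => a = v
    | Sum.inr _, Sum.inl b => b = v
    | Sum.inr _, Sum.inr _ => False
  symm := ⟨by
    rintro (a | i) (b | j) h
    · exact SimpleGraph.Adj.symm h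
    · exact h
    · exact h
    · exact h⟩
  loopless := ⟨by
    rintro (a | i) h
    · exact G.irrefl h
    · exact h⟩

/-- The double star `D(p, q)` (for `p, q ≥ 1`): the star `K_{1,p}` with centre `0`, with `q - 1`
pendant edges attached to its non-central vertex `Fin.last p`. -/
def doubleStar (p q : ℕ) : SimpleGraph (Fin (p + 1) ⊕ Fin (q - 1)) :=
  attachPendants (SimpleGraph.starGraph (0 : Fin (p + 1))) (Fin.last p) (q - 1)

/-- The tree `B(p, q)`, bundled with its vertex type.
For `q ≥ p ≥ 3`: a pendant edge is attached to `D(p - 1, q)` at a vertex of degree one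
that is joined to the vertex of degree `q` (the vertex `Sum.inl (Fin.last (p - 1))`).
For `q ≥ p = 2`: `q - 2` pendant edges are attached to an end vertex of the path `P_4`.
(The values for `p < 2` and for `q < p` are irrelevant.) -/
def treeB (p q : ℕ) : (W : Type) × SimpleGraph W :=
  if h : 3 ≤ p ∧ p ≤ q then
    ⟨(Fin (p - 1 + 1) ⊕ Fin (q - 1)) ⊕ Fin 1,
      attachPendants (doubleStar (p - 1) q) (Sum.inr ⟨0, by omega⟩) 1⟩
  else
    ⟨Fin 4 ⊕ Fin (q - 2), attachPendants (SimpleGraph.pathGraph 4) 0 (q - 2)⟩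

/-- The tree `P_k(a, b)` (for `k ≥ 1`): `a` and `b` pendant vertices are attached to the two end
vertices of the path `P_k`, respectively.  For `k = 1` the two end vertices coincide and
the result is the star `K_{1,a+b}`. -/
def pathWithPendants (k a b : ℕ) : SimpleGraph ((Fin (k - 1 + 1) ⊕ Fin a) ⊕ Fin b) :=
  attachPendants (attachPendants (SimpleGraph.pathGraph (k - 1 + 1)) 0 a)
    (Sum.inl (Fin.last (k - 1))) b

/-!
The number of subtrees of a tree is controlled by deleting leaves. If `v` is a leaf with neighbour
`w`, then the subtrees containing `v` are `{v}` and the sets `S ∪ {v}` with `S` a subtree through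
`w`, so that the tree loses one more subtree than there are subtrees of the smaller tree through
`w` (`weightedCount_erase`).

*Maximum.* The deletion formula reduces the upper bounds to bounds for the number of subtrees
through a root `u`: one for an arbitrary tree (`count_singleton_le`), one for a root that is not
adjacent to the whole opposite class (`count_singleton_le_of_not_dominates`), and one for trees that
are not double stars (`count_singleton_le_of_not_isDoubleStar`). The tree spanned by the classes
`P` and `Q` is a double star iff each class contains a vertex adjacent to all of the opposite class.
Suppose that it is not one, and that `|P| ≤ |Q|`. The class `Q` contains a leaf, as the degrees of
its vertices sum to `|P| + |Q| - 1`. If `|P| < |Q|`, such a leaf is deleted. If `|P| = |Q|`, both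
classes contain leaves, and one of these has a neighbour that is not adjacent to its whole opposite
class, since otherwise the two neighbours would be the centres of a double star; that leaf is
deleted. In either case the root bounds are exactly strong enough for an induction, and following
the equality cases through it leaves only `B(p, q)` (`count_le_of_three_le_card`; the case `p = 2`
is `count_le_of_card_eq_two`). The induction starts from the trees that become double stars when
the leaf is deleted.
The double star itself has more subtrees than `B(p, q)`, by comparison of the two exact counts.

*Minimum.* The class of size `q` contains at least `q - p + 1` leaves. Let `K` consist of exactly
`q - p + 1` of them. The remaining `2p - 1` vertices form a tree `I`, and with `w x` the number of
vertices of `K` adjacent to `x`, the number of subtrees is `|K| + ∑ 2 ^ w(S)`, the sum running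
over the subtrees `S` of `I` (`weightedCount_union_leaves`). Contracting the edge at a leaf `v` of
`I` with neighbour `u` changes the sum by `2 ^ w(v)` plus the sum over the subtrees of `I - v`
through `u`. The latter contains the terms of `I - v` and of `{u}`, and at least `|I - v| - 2`
further ones. As `2 ^ s + 2 ^ t` for fixed `s + t` is smallest when `s` and `t` are as equal as
possible, this gives the bound of `le_weightedCount`, with equality only for a path all of whose
weight lies at its ends.
-/

section

open scoped Classical

variable {V : Type*} {G : SimpleGraph V}

/-! ### Subtrees spanned by finite vertex sets -/

/-- The finite vertex set `A` induces a connected (in particular non-empty) subgraph of `G`. In an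
acyclic `G` these sets are exactly the vertex sets of the finite subtrees. -/
def SpansSubtree (G : SimpleGraph V) (A : Finset V) : Prop :=
  (G.induce (A : Set V)).Connected

/-- `v` is a leaf of the subgraph induced by `A`, and `u` is its only neighbour there. -/
structure PendantAt (G : SimpleGraph V) (A : Finset V) (v u : V) : Prop where
  mem : v ∈ A
  nbr_mem : u ∈ A
  adj : G.Adj v u
  unique : ∀ x ∈ A, G.Adj v x → x = u

theorem SpansSubtree.nonempty {A : Finset V} (h : SpansSubtree G A) : A.Nonempty := by
  obtain ⟨x⟩ := SimpleGraph.Connected.nonempty h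
  exact ⟨x.1, x.2⟩

/-- A non-empty vertex set induces a connected subgraph iff no proper non-empty part of it is
disconnected from the rest. -/
theorem spansSubtree_iff_cut {A : Finset V} :
    SpansSubtree G A ↔ A.Nonempty ∧ ∀ B ⊆ A, B.Nonempty → B ≠ A →
      ∃ x ∈ B, ∃ y ∈ A, y ∉ B ∧ G.Adj x y := by
  constructor
  · intro h
    refine ⟨h.nonempty, fun B hBA ⟨x, hx⟩ hne => ?_⟩
    obtain ⟨y, hyA, hyB⟩ : ∃ y ∈ A, y ∉ B := by
      by_contra! hc
      exact hne (Finset.Subset.antisymm hBA hc)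
    obtain ⟨p⟩ := h.preconnected ⟨x, hBA hx⟩ ⟨y, hyA⟩
    obtain ⟨d, -, h1, h2⟩ := p.exists_boundary_dart {z | z.1 ∈ B} hx hyB
    exact ⟨d.fst.1, h1, d.snd.1, d.snd.2, h2, d.adj⟩
  · rintro ⟨⟨a, ha⟩, hcut⟩
    rw [SpansSubtree, SimpleGraph.connected_iff_exists_forall_reachable]
    refine ⟨⟨a, ha⟩, ?_⟩
    let B := A.filter fun z => ∃ hz : z ∈ A, (G.induce (A : Set V)).Reachable ⟨a, ha⟩ ⟨z, hz⟩
    have haB : a ∈ B := Finset.mem_filter.2 ⟨ha, ha, SimpleGraph.Reachable.refl _⟩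
    have hB : B = A := by
      by_contra hne
      obtain ⟨x, hx, y, hyA, hyB, hadj⟩ := hcut B (Finset.filter_subset _ _) ⟨a, haB⟩ hne
      obtain ⟨-, hxA, hr⟩ := Finset.mem_filter.1 hx
      refine hyB (Finset.mem_filter.2 ⟨hyA, hyA, hr.trans ?_⟩)
      exact SimpleGraph.Adj.reachable (G := G.induce (A : Set V)) (u := ⟨x, hxA⟩)
        (v := ⟨y, hyA⟩) hadj
    rintro ⟨z, hz⟩
    have hzB : z ∈ B := by rw [hB]; exact hz
    exact (Finset.mem_filter.1 hzB).2.2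

theorem spansSubtree_singleton (v : V) : SpansSubtree G {v} := by
  rw [spansSubtree_iff_cut]
  refine ⟨⟨v, by simp⟩, fun B hB hne hne' => ?_⟩
  rcases Finset.subset_singleton_iff.1 hB with h | h
  · exact absurd h hne.ne_empty
  · exact absurd h hne'

theorem SpansSubtree.exists_adj {A : Finset V} (h : SpansSubtree G A) {v y : V} (hv : v ∈ A)
    (hy : y ∈ A) (hne : y ≠ v) : ∃ x ∈ A, G.Adj v x := by
  obtain ⟨x, hx, z, hz, -, hadj⟩ := (spansSubtree_iff_cut.1 h).2 {v} (by simpa using hv) (by simp)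
    (by rintro rfl; exact hne (by simpa using hy))
  rw [Finset.mem_singleton] at hx
  exact ⟨z, hz, hx ▸ hadj⟩

theorem SpansSubtree.insert_adj {A : Finset V} (h : SpansSubtree G A) {u v : V}
    (hu : u ∈ A) (hadj : G.Adj v u) : SpansSubtree G (insert v A) := by
  have h1 := SimpleGraph.connected_induce_union h.preconnected
    (spansSubtree_singleton (G := G) v).preconnected (v := u) (w := v) hu (by simp) hadj.symm
  have h2 : ((A : Set V) ∪ (({v} : Finset V) : Set V)) =
      ((Insert.insert v A : Finset V) : Set V) := by
    ext x; simp
  rw [h2] at h1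
  exact h1

theorem PendantAt.ne {A : Finset V} {v u : V} (h : PendantAt G A v u) : v ≠ u := h.adj.ne

theorem PendantAt.nbr_mem_erase {A : Finset V} {v u : V} (h : PendantAt G A v u) :
    u ∈ A.erase v := Finset.mem_erase.2 ⟨h.ne.symm, h.nbr_mem⟩

theorem SpansSubtree.erase {A : Finset V} (h : SpansSubtree G A) {v u : V}
    (hp : PendantAt G A v u) : SpansSubtree G (A.erase v) := by
  rw [spansSubtree_iff_cut] at h ⊢
  refine ⟨⟨u, hp.nbr_mem_erase⟩, fun B hB hne hne' => ?_⟩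
  have hBA : B ⊆ A := hB.trans (Finset.erase_subset _ _)
  have hvB : v ∉ B := fun hv => by simpa using hB hv
  by_cases huB : u ∈ B
  · obtain ⟨x, hx, y, hy, hyB, hadj⟩ := h.2 (insert v B)
      (Finset.insert_subset hp.mem hBA) (by simp) (by
        rintro rfl
        rw [Finset.erase_insert hvB] at hne'
        exact hne' rfl)
    rw [Finset.mem_insert, not_or] at hyB
    refine ⟨x, ?_, y, Finset.mem_erase.2 ⟨hyB.1, hy⟩, hyB.2, hadj⟩
    rcases Finset.mem_insert.1 hx with rfl | hx
    · exact absurd huB (hp.unique y hy hadj ▸ hyB.2)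
    · exact hx
  · obtain ⟨x, hx, y, hy, hyB, hadj⟩ := h.2 B hBA hne (by rintro rfl; exact hvB hp.mem)
    refine ⟨x, hx, y, Finset.mem_erase.2 ⟨?_, hy⟩, hyB, hadj⟩
    rintro rfl
    exact huB (hp.unique x (hBA hx) hadj.symm ▸ hx)

/-- A finite subtree with at least two vertices has a leaf different from any prescribed vertex. -/
theorem SpansSubtree.exists_pendant {A : Finset V} (hG : G.IsAcyclic) (h : SpansSubtree G A)
    (hA : 2 ≤ A.card) (u : V) : ∃ v w, v ≠ u ∧ PendantAt G A v w := by
  have ht : (G.induce (A : Set V)).IsTree := ⟨h, hG.induce _⟩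
  have : Nontrivial (A : Set V) := by
    rw [Set.nontrivial_coe_sort]
    exact Finset.one_lt_card_iff_nontrivial.1 hA
  obtain ⟨a, b, hab, ha, hb⟩ := ht.exists_ne_and_degree_eq_one
  have key : ∀ c : (A : Set V), (G.induce (A : Set V)).degree c = 1 →
      ∃ w, PendantAt G A c.1 w := by
    intro c hc
    obtain ⟨w, hw, huniq⟩ := SimpleGraph.degree_eq_one_iff_existsUnique_adj.1 hc
    exact ⟨w.1, c.2, w.2, hw, fun x hx hadj => congrArg Subtype.val (huniq ⟨x, hx⟩ hadj)⟩
  by_cases hau : a.1 = u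
  · obtain ⟨w, hw⟩ := key b hb
    exact ⟨b.1, w, fun hbu => hab (Subtype.ext (hau.trans hbu.symm)), hw⟩
  · obtain ⟨w, hw⟩ := key a ha
    exact ⟨a.1, w, hau, hw⟩

theorem SpansSubtree.exists_path {A : Finset V} (h : SpansSubtree G A) {a b : V} (ha : a ∈ A)
    (hb : b ∈ A) : ∃ p : G.Path a b, ∀ x ∈ p.1.support, x ∈ A := by
  obtain ⟨p, hp⟩ := h.preconnected.exists_isPath ⟨a, ha⟩ ⟨b, hb⟩
  let f : G.induce (A : Set V) ↪g G := SimpleGraph.Embedding.induce _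
  have hmem : ∀ x ∈ (p.map f.toHom).support, x ∈ A := by
    intro x hx
    rw [SimpleGraph.Walk.support_map, List.mem_map] at hx
    obtain ⟨y, -, rfl⟩ := hx
    exact y.2
  exact ⟨⟨p.map f.toHom, (SimpleGraph.Walk.isPath_map_iff_of_injective f.injective).2 hp⟩, hmem⟩

/-- In an acyclic graph, the neighbour of `z` on the way to `u` lies in every subtree that contains
both `u` and `z`. -/
theorem SpansSubtree.exists_forced {A : Finset V} (hG : G.IsAcyclic) (h : SpansSubtree G A)
    {u z : V} (hu : u ∈ A) (hz : z ∈ A) (hne : z ≠ u) :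
    ∃ x ∈ A, G.Adj z x ∧ ∀ S, SpansSubtree G S → u ∈ S → z ∈ S → x ∈ S := by
  obtain ⟨⟨p, hp⟩, -⟩ := h.exists_path hz hu
  cases p with
  | nil => exact absurd rfl hne
  | @cons _ x _ hadj p' =>
    have hS : ∀ S, SpansSubtree G S → u ∈ S → z ∈ S → x ∈ S := by
      intro S hS huS hzS
      obtain ⟨q, hq⟩ := hS.exists_path hzS huS
      rw [(hG.subsingleton_path _ _).elim q ⟨_, hp⟩] at hq
      exact hq x (by simp)
    exact ⟨x, hS A h hu hz, hadj, hS⟩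

/-- An acyclic graph has no 4-cycle. -/
theorem SimpleGraph.IsAcyclic.eq_of_common_adj (hG : G.IsAcyclic) {x y a b : V} (hxy : x ≠ y)
    (hxa : G.Adj x a) (hay : G.Adj a y) (hxb : G.Adj x b) (hby : G.Adj b y) : a = b := by
  have h := (hG.subsingleton_path x y).elim
    ⟨.cons hxa (.cons hay .nil), by simp [hxa.ne, hay.ne, hxy]⟩
    ⟨.cons hxb (.cons hby .nil), by simp [hxb.ne, hby.ne, hxy]⟩
  have h' := congrArg (fun p : G.Path x y => p.1.support) h
  simpa using h'

/-! ### Weighted counts of subtrees and deletion of a leaf -/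

/-- The number of subtrees `S` with `R ⊆ S ⊆ A`, each counted with the weight `2 ^ ∑ x ∈ S, w x`.
This is the number of subtrees that arise when `w x` further leaves are attached to each
vertex `x`, except for those consisting of a single new leaf. -/
noncomputable def weightedCount (G : SimpleGraph V) (w : V → ℕ) (A R : Finset V) : ℕ :=
  ∑ S ∈ A.powerset with SpansSubtree G S ∧ R ⊆ S, 2 ^ ∑ x ∈ S, w x

/-- The number of subtrees `S` with `R ⊆ S ⊆ A`. -/
noncomputable abbrev countContaining (G : SimpleGraph V) (A R : Finset V) : ℕ :=
  weightedCount G 0 A R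

theorem countContaining_eq_card (A R : Finset V) : countContaining G A R =
    (A.powerset.filter fun S => SpansSubtree G S ∧ R ⊆ S).card := by
  simp [countContaining, weightedCount]

theorem PendantAt.spans_insert_iff {A S : Finset V} {v u : V}
    (hp : PendantAt G A v u) (hS : S ⊆ A.erase v) :
    SpansSubtree G (insert v S) ↔ S = ∅ ∨ (u ∈ S ∧ SpansSubtree G S) := by
  have hvS : v ∉ S := fun h => by simpa using hS h
  have hSA : S ⊆ A := hS.trans (Finset.erase_subset _ _)
  constructor
  · intro h
    rcases S.eq_empty_or_nonempty with h0 | ⟨y, hy⟩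
    · exact Or.inl h0
    right
    obtain ⟨x, hx, hadj⟩ := h.exists_adj (Finset.mem_insert_self v S)
      (Finset.mem_insert_of_mem hy) (by rintro rfl; exact hvS hy)
    have hxS : x ∈ S := (Finset.mem_insert.1 hx).resolve_left hadj.ne'
    obtain rfl := hp.unique x (hSA hxS) hadj
    have hp' : PendantAt G (insert v S) v x :=
      ⟨Finset.mem_insert_self _ _, hx, hadj, fun z hz hz' => hp.unique z
        (Finset.insert_subset hp.mem hSA hz) hz'⟩
    refine ⟨hxS, ?_⟩
    simpa [Finset.erase_insert hvS] using h.erase hp'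
  · rintro (rfl | ⟨hu, h⟩)
    · exact spansSubtree_singleton v
    · exact h.insert_adj hu hp.adj

/-- Deletion of a leaf `v` with neighbour `u`: the subtrees containing `v` are `{v}` and those
obtained by adding `v` to a subtree containing `u`. -/
theorem weightedCount_erase (w : V → ℕ) {A R : Finset V} {v u : V}
    (hp : PendantAt G A v u) (hvR : v ∉ R) :
    weightedCount G w A R = weightedCount G w (A.erase v) R +
      ((if R = ∅ then 2 ^ w v else 0) + 2 ^ w v * weightedCount G w (A.erase v) (insert u R)) := by
  have hvE : v ∉ A.erase v := by simp
  unfold weightedCount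
  simp only [Finset.sum_filter]
  conv_lhs => rw [← Finset.insert_erase hp.mem]
  rw [Finset.sum_powerset_insert hvE]
  congr 1
  rw [Finset.mul_sum]
  have h0 : (if R = ∅ then 2 ^ w v else 0) =
      ∑ S ∈ (A.erase v).powerset, if S = ∅ then (if R = ∅ then 2 ^ w v else 0) else 0 := by
    rw [Finset.sum_ite_eq' (A.erase v).powerset ∅]
    simp
  rw [h0, ← Finset.sum_add_distrib]
  refine Finset.sum_congr rfl fun S hS => ?_
  rw [Finset.mem_powerset] at hS
  have hvS : v ∉ S := fun h => hvE (hS h)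
  simp only [hp.spans_insert_iff hS, Finset.subset_insert_iff_of_notMem hvR,
    Finset.sum_insert hvS]
  rcases S.eq_empty_or_nonempty with rfl | hne
  · have : ¬ SpansSubtree G (∅ : Finset V) := fun h => by simpa using h.nonempty
    simp [this]
  · simp only [hne.ne_empty, if_false, false_or, zero_add, Finset.insert_subset_iff, pow_add]
    by_cases h1 : u ∈ S <;> by_cases h2 : SpansSubtree G S <;> by_cases h3 : R ⊆ S <;>
      simp [h1, h2, h3]

theorem weightedCount_of_mem (w : V → ℕ) {A R : Finset V} {v u : V}
    (hp : PendantAt G A v u) (hvR : v ∈ R) :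
    weightedCount G w A R = (if R = {v} then 2 ^ w v else 0) +
      2 ^ w v * weightedCount G w (A.erase v) (insert u (R.erase v)) := by
  have hvE : v ∉ A.erase v := by simp
  unfold weightedCount
  simp only [Finset.sum_filter]
  conv_lhs => rw [← Finset.insert_erase hp.mem]
  rw [Finset.sum_powerset_insert hvE, Finset.mul_sum]
  have h0 : (if R = {v} then 2 ^ w v else 0) =
      ∑ S ∈ (A.erase v).powerset, if S = ∅ then (if R = {v} then 2 ^ w v else 0) else 0 := by
    rw [Finset.sum_ite_eq' (A.erase v).powerset ∅]
    simp
  have h1 : ∑ S ∈ (A.erase v).powerset,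
      (if SpansSubtree G S ∧ R ⊆ S then 2 ^ ∑ x ∈ S, w x else 0) = 0 := by
    refine Finset.sum_eq_zero fun S hS => if_neg fun h => ?_
    exact hvE (Finset.mem_powerset.1 hS (h.2 hvR))
  rw [h0, h1, zero_add, ← Finset.sum_add_distrib]
  refine Finset.sum_congr rfl fun S hS => ?_
  rw [Finset.mem_powerset] at hS
  have hvS : v ∉ S := fun h => hvE (hS h)
  simp only [hp.spans_insert_iff hS, Finset.subset_insert_iff, Finset.sum_insert hvS]
  rcases S.eq_empty_or_nonempty with rfl | hne
  · have h2 : ¬ SpansSubtree G (∅ : Finset V) := fun h => by simpa using h.nonempty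
    have h3 : R.erase v ⊆ ∅ ↔ R = {v} := by
      rw [Finset.subset_empty, Finset.erase_eq_empty_iff]
      exact ⟨fun h => h.resolve_left (by rintro rfl; simp at hvR), Or.inr⟩
    simp only [h2, h3]
    simp
  · simp only [hne.ne_empty, if_false, false_or, zero_add, Finset.insert_subset_iff, pow_add]
    by_cases h1 : u ∈ S <;> by_cases h2 : SpansSubtree G S <;> by_cases h3 : R.erase v ⊆ S <;>
      simp [h1, h2, h3]

/-- Adding `m` to the weight of `u` multiplies the contribution of the subtrees through `u`
by `2 ^ m`. -/
theorem weightedCount_update (w : V → ℕ) (A R : Finset V) (u : V) (m : ℕ) :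
    weightedCount G (Function.update w u (w u + m)) A R + weightedCount G w A (insert u R) =
      weightedCount G w A R + 2 ^ m * weightedCount G w A (insert u R) := by
  unfold weightedCount
  simp only [Finset.sum_filter, Finset.mul_sum, ← Finset.sum_add_distrib]
  refine Finset.sum_congr rfl fun S _ => ?_
  by_cases hu : u ∈ S
  · have h : ∑ x ∈ S, Function.update w u (w u + m) x = m + ∑ x ∈ S, w x := by
      rw [Finset.sum_update_of_mem hu, ← Finset.add_sum_erase S w hu,
        Finset.sdiff_singleton_eq_erase]
      ring
    simp only [h, Finset.insert_subset_iff, hu, true_and, pow_add]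
    split_ifs <;> ring
  · have h : ∑ x ∈ S, Function.update w u (w u + m) x = ∑ x ∈ S, w x :=
      Finset.sum_congr rfl fun x hx => Function.update_of_ne (by rintro rfl; exact hu hx) _ _
    simp only [h, Finset.insert_subset_iff, hu, false_and, and_false, if_false]
    simp

theorem countContaining_erase {A R : Finset V} {v u : V}
    (hp : PendantAt G A v u) (hvR : v ∉ R) :
    countContaining G A R = countContaining G (A.erase v) R +
      ((if R = ∅ then 1 else 0) + countContaining G (A.erase v) (insert u R)) := by
  simpa using weightedCount_erase 0 hp hvR

theorem countContaining_empty_erase {A : Finset V} {v u : V}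
    (hp : PendantAt G A v u) : countContaining G A ∅ = countContaining G (A.erase v) ∅ +
      (1 + countContaining G (A.erase v) {u}) := by
  simpa using countContaining_erase hp (Finset.notMem_empty v)

theorem countContaining_singleton_erase {A : Finset V} {v u x : V}
    (hp : PendantAt G A v u) (hx : x ≠ v) : countContaining G A {x} =
      countContaining G (A.erase v) {x} + countContaining G (A.erase v) {u, x} := by
  simpa using countContaining_erase (R := {x}) hp (by simpa using hx.symm)

theorem countContaining_leaf {A : Finset V} {v u : V} (hp : PendantAt G A v u) :
    countContaining G A {v} = 1 + countContaining G (A.erase v) {u} := by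
  simpa using weightedCount_of_mem 0 hp (Finset.mem_singleton_self v)

theorem countContaining_leaf_nbr {A : Finset V} {v u : V}
    (hp : PendantAt G A v u) : countContaining G A {v, u} = countContaining G (A.erase v) {u} := by
  have h := weightedCount_of_mem 0 hp (Finset.mem_insert_self v {u})
  have h1 : ({v, u} : Finset V).erase v = {u} := Finset.erase_insert (by simpa using hp.ne)
  have h2 : ({v, u} : Finset V) ≠ {v} := fun h => hp.ne.symm (by
    have : u ∈ ({v} : Finset V) := h ▸ (by simp)
    simpa using this)
  rw [h1, if_neg h2] at h
  simpa using h

theorem countContaining_le_of_forced {A R R' : Finset V}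
    (h : ∀ S, SpansSubtree G S → R ⊆ S → R' ⊆ S) :
    countContaining G A R ≤ countContaining G A R' := by
  rw [countContaining_eq_card, countContaining_eq_card]
  exact Finset.card_le_card (Finset.monotone_filter_right _ fun S _ hS => ⟨hS.1, h S hS.1 hS.2⟩)

theorem countContaining_split (A R : Finset V) (y : V) :
    countContaining G A R =
      countContaining G A (insert y R) + countContaining G (A.erase y) R := by
  simp only [countContaining_eq_card]
  rw [← Finset.card_filter_add_card_filter_not (p := fun S : Finset V => y ∈ S)]
  congr 2
  · ext S
    simp only [Finset.mem_filter, Finset.mem_powerset, Finset.insert_subset_iff]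
    tauto
  · ext S
    simp only [Finset.mem_filter, Finset.mem_powerset, Finset.subset_erase]
    tauto

/-- A subtree containing `R` is determined by its remaining vertices. -/
theorem two_pow_card_mul_countContaining_le {A R : Finset V} (hR : R ⊆ A) :
    2 ^ R.card * countContaining G A R ≤ 2 ^ A.card := by
  have h : countContaining G A R ≤ 2 ^ (A.card - R.card) := by
    rw [countContaining_eq_card, ← Finset.card_sdiff_of_subset hR, ← Finset.card_powerset]
    refine Finset.card_le_card_of_injOn (fun S => S \ R) ?_ ?_
    · intro S hS
      simp only [Finset.coe_filter, Finset.mem_powerset, Set.mem_ofPred_eq] at hS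
      exact Finset.mem_coe.2 (Finset.mem_powerset.2 (Finset.sdiff_subset_sdiff hS.1 (le_refl R)))
    · intro S hS T hT hST
      simp only [Finset.coe_filter, Finset.mem_powerset, Set.mem_ofPred_eq] at hS hT hST
      rw [← Finset.sdiff_union_of_subset hS.2.2, hST, Finset.sdiff_union_of_subset hT.2.2]
  calc 2 ^ R.card * countContaining G A R ≤ 2 ^ R.card * 2 ^ (A.card - R.card) :=
        Nat.mul_le_mul_left _ h
    _ = 2 ^ A.card := by rw [← pow_add, Nat.add_sub_cancel' (Finset.card_le_card hR)]

theorem countContaining_pair_le {A : Finset V} {u w : V} (hu : u ∈ A) (hw : w ∈ A)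
    (hne : w ≠ u) : 4 * countContaining G A {w, u} ≤ 2 ^ A.card := by
  have h := two_pow_card_mul_countContaining_le (G := G) (A := A) (R := {w, u})
    (by simp [Finset.insert_subset_iff, hu, hw])
  rwa [Finset.card_pair hne] at h

/-- Subtrees containing two non-adjacent vertices also contain a vertex between them. -/
theorem countContaining_pair_le_of_not_adj (hG : G.IsAcyclic) {A : Finset V}
    (hA : SpansSubtree G A) {u w : V} (hu : u ∈ A) (hw : w ∈ A) (hne : w ≠ u)
    (hadj : ¬ G.Adj w u) : 8 * countContaining G A {w, u} ≤ 2 ^ A.card := by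
  obtain ⟨x, hx, hwx, hforce⟩ := hA.exists_forced hG hu hw hne
  have hxu : x ≠ u := by rintro rfl; exact hadj hwx
  have h1 : countContaining G A {w, u} ≤ countContaining G A {x, w, u} := by
    refine countContaining_le_of_forced fun S hS hR => ?_
    simp only [Finset.insert_subset_iff, Finset.singleton_subset_iff] at hR ⊢
    exact ⟨hforce S hS hR.2 hR.1, hR⟩
  have h2 := two_pow_card_mul_countContaining_le (G := G) (A := A) (R := {x, w, u})
    (by simp [Finset.insert_subset_iff, hu, hw, hx])
  rw [Finset.card_insert_of_notMem (by simp [hwx.ne', hxu]), Finset.card_pair hne] at h2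
  omega

/-- If `y` is adjacent neither to `u` nor to `w`, then a subtree containing `u`, `w` and `y` must
contain a fourth vertex, so at most three quarters of all vertex sets containing `u` and `w`
span subtrees. -/
theorem countContaining_pair_le_of_far (hG : G.IsAcyclic) {A : Finset V}
    (hA : SpansSubtree G A) {u w y : V} (hu : u ∈ A) (hw : w ∈ A) (hy : y ∈ A) (hne : w ≠ u)
    (hyu : y ≠ u) (hyw : y ≠ w) (hadju : ¬ G.Adj y u) (hadjw : ¬ G.Adj y w) :
    16 * countContaining G A {w, u} ≤ 3 * 2 ^ A.card := by
  obtain ⟨x, hx, hyx, hforce⟩ := hA.exists_forced hG hu hy hyu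
  have hxu : x ≠ u := by rintro rfl; exact hadju hyx
  have hxw : x ≠ w := by rintro rfl; exact hadjw hyx
  have h1 : countContaining G A {y, w, u} ≤ countContaining G A {x, y, w, u} := by
    refine countContaining_le_of_forced fun S hS hR => ?_
    simp only [Finset.insert_subset_iff, Finset.singleton_subset_iff] at hR ⊢
    exact ⟨hforce S hS hR.2.2 hR.1, hR⟩
  have h2 := two_pow_card_mul_countContaining_le (G := G) (A := A) (R := {x, y, w, u})
    (by simp [Finset.insert_subset_iff, hu, hw, hx, hy])
  rw [Finset.card_insert_of_notMem (by simp [hyx.ne', hxu, hxw]),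
    Finset.card_insert_of_notMem (by simp [hyu, hyw]), Finset.card_pair hne] at h2
  have h3 := countContaining_pair_le (G := G) (Finset.mem_erase.2 ⟨hyu.symm, hu⟩)
    (Finset.mem_erase.2 ⟨hyw.symm, hw⟩) hne
  have h4 := countContaining_split (G := G) A {w, u} y
  have h5 : 2 ^ A.card = 2 * 2 ^ (A.erase y).card := by
    rw [← Finset.card_erase_add_one hy, pow_succ, mul_comm]
  omega

theorem countContaining_pair_le_singleton (A : Finset V) (u w : V) :
    countContaining G A {w, u} ≤ countContaining G A {u} :=
  countContaining_le_of_forced fun _ _ hR => (Finset.subset_insert _ _).trans hR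

/-! ### Bipartite subtrees and double stars -/

/-- The disjoint sets `P` and `Q` are independent in `G`, and `P ∪ Q` spans a subtree: `(P, Q)` is
the bipartition of a subtree of `G`. The order of the two classes matters. -/
structure BiSubtree (G : SimpleGraph V) (P Q : Finset V) : Prop where
  disj : Disjoint P Q
  indep_left : ∀ x ∈ P, ∀ y ∈ P, ¬ G.Adj x y
  indep_right : ∀ x ∈ Q, ∀ y ∈ Q, ¬ G.Adj x y
  spans : SpansSubtree G (P ∪ Q)

/-- `c` is adjacent to all vertices of `P`. -/
def Dominates (G : SimpleGraph V) (c : V) (P : Finset V) : Prop := ∀ x ∈ P, G.Adj c x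

/-- The subtree with bipartition `(P, Q)` is a double star with centres `c ∈ Q` and `d ∈ P`
(possibly a star). -/
structure DoubleStarAt (G : SimpleGraph V) (P Q : Finset V) (c d : V) : Prop where
  c_mem : c ∈ Q
  d_mem : d ∈ P
  dom_c : Dominates G c P
  dom_d : Dominates G d Q

/-- The subtree with bipartition `(P, Q)` is a double star or a star. -/
def IsDoubleStar (G : SimpleGraph V) (P Q : Finset V) : Prop := ∃ c d, DoubleStarAt G P Q c d

/-- The subtree with bipartition `(P, Q)` has a vertex `d ∈ P` adjacent to all of `Q`, and a vertex
`c ∈ Q` adjacent to all vertices of `P` but one. For `3 ≤ |P| ≤ |Q|` this describes `B(|P|, |Q|)`,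
and for `|Q| = 2 ≤ |P|` it describes `B(2, |P|)`. -/
def IsNearDoubleStar (G : SimpleGraph V) (P Q : Finset V) : Prop :=
  ∃ d ∈ P, ∃ c ∈ Q, ∃ y ∈ P, Dominates G d Q ∧ ¬ G.Adj c y ∧ Dominates G c (P.erase y)

theorem DoubleStarAt.symm {P Q : Finset V} {c d : V} (h : DoubleStarAt G P Q c d) :
    DoubleStarAt G Q P d c := ⟨h.d_mem, h.c_mem, h.dom_d, h.dom_c⟩

theorem IsDoubleStar.symm {P Q : Finset V} (h : IsDoubleStar G P Q) : IsDoubleStar G Q P := by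
  obtain ⟨c, d, h⟩ := h
  exact ⟨d, c, h.symm⟩

theorem two_pow_card_erase {Q : Finset V} {v : V} (hv : v ∈ Q) :
    2 ^ Q.card = 2 * 2 ^ (Q.erase v).card := by
  rw [← Finset.card_erase_add_one hv, pow_succ, mul_comm]

theorem two_pow_add_card_erase {Q : Finset V} {v : V} (hv : v ∈ Q) (p : ℕ) :
    2 ^ (p + Q.card) = 2 * 2 ^ (p + (Q.erase v).card) := by
  rw [← Finset.card_erase_add_one hv, ← add_assoc, pow_succ, mul_comm]

namespace BiSubtree

variable {P Q : Finset V}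

theorem symm (h : BiSubtree G P Q) : BiSubtree G Q P :=
  ⟨h.disj.symm, h.indep_right, h.indep_left, Finset.union_comm P Q ▸ h.spans⟩

theorem card_union (h : BiSubtree G P Q) : (P ∪ Q).card = P.card + Q.card :=
  Finset.card_union_of_disjoint h.disj

theorem notMem_left (h : BiSubtree G P Q) {v : V} (hv : v ∈ Q) : v ∉ P :=
  fun hv' => Finset.disjoint_left.1 h.disj hv' hv

theorem erase_union (h : BiSubtree G P Q) {v : V} (hv : v ∈ Q) :
    (P ∪ Q).erase v = P ∪ Q.erase v := by
  rw [Finset.erase_union_distrib, Finset.erase_eq_of_notMem (h.notMem_left hv)]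

theorem nbr_mem (h : BiSubtree G P Q) {v w : V} (hv : v ∈ Q) (hp : PendantAt G (P ∪ Q) v w) :
    w ∈ P :=
  (Finset.mem_union.1 hp.nbr_mem).resolve_right fun hw => h.indep_right v hv w hw hp.adj

theorem erase (h : BiSubtree G P Q) {v w : V} (hv : v ∈ Q) (hp : PendantAt G (P ∪ Q) v w) :
    BiSubtree G P (Q.erase v) where
  disj := h.disj.mono_right (Finset.erase_subset _ _)
  indep_left := h.indep_left
  indep_right x hx y hy := h.indep_right x (Finset.mem_of_mem_erase hx) y
    (Finset.mem_of_mem_erase hy)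
  spans := h.erase_union hv ▸ h.spans.erase hp

theorem pendant_symm {v w : V} (hp : PendantAt G (P ∪ Q) v w) : PendantAt G (Q ∪ P) v w :=
  Finset.union_comm P Q ▸ hp

theorem exists_adj (h : BiSubtree G P Q) (hP : P.Nonempty) {z : V} (hz : z ∈ Q) :
    ∃ x ∈ P, G.Adj z x := by
  obtain ⟨y, hy⟩ := hP
  obtain ⟨x, hx, hadj⟩ := h.spans.exists_adj (Finset.mem_union_right P hz)
    (Finset.mem_union_left Q hy) (by rintro rfl; exact h.notMem_left hz hy)
  exact ⟨x, (Finset.mem_union.1 hx).resolve_right fun hx => h.indep_right z hz x hx hadj, hadj⟩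

theorem dominates_of_card_eq_one (h : BiSubtree G P Q) (hP : P.card = 1) :
    ∃ d ∈ P, Dominates G d Q := by
  obtain ⟨d, rfl⟩ := Finset.card_eq_one.1 hP
  refine ⟨d, by simp, fun z hz => ?_⟩
  obtain ⟨x, hx, hadj⟩ := h.exists_adj ⟨d, by simp⟩ hz
  rw [Finset.mem_singleton] at hx
  exact hx ▸ hadj.symm

theorem two_le_card_left (h : BiSubtree G P Q) (hQ : Q.Nonempty) (hP : P.Nonempty)
    (hD : ¬ IsDoubleStar G P Q) : 2 ≤ P.card := by
  by_contra hc
  have h1 : P.card = 1 := by have := hP.card_pos; omega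
  obtain ⟨d, hd, hdom⟩ := h.dominates_of_card_eq_one h1
  obtain ⟨c, hc⟩ := hQ
  refine hD ⟨c, d, hc, hd, fun x hx => ?_, hdom⟩
  obtain rfl : x = d := Finset.card_le_one.1 h1.le x hx d hd
  exact (hdom c hc).symm

/-- If `u` is adjacent to all other vertices of `P`, then the vertices of `Q` other than `u` are
leaves. -/
theorem pendant_of_dominates (hG : G.IsAcyclic) (h : BiSubtree G P Q) {u v w : V}
    (hdom : Dominates G u P) (hv : v ∈ Q) (hvu : v ≠ u) (hw : w ∈ P) (hadj : G.Adj v w) :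
    PendantAt G (P ∪ Q) v w where
  mem := Finset.mem_union_right _ hv
  nbr_mem := Finset.mem_union_left _ hw
  adj := hadj
  unique x hx hx' := by
    have hxP : x ∈ P := (Finset.mem_union.1 hx).resolve_right fun hx => h.indep_right v hv x hx hx'
    exact hG.eq_of_common_adj hvu hx' (hdom x hxP).symm hadj (hdom w hw).symm

end BiSubtree

/-! ### The number of subtrees containing a given vertex -/

/-- Bound for an arbitrary root `u`. It is attained by a centre of a double star. -/
theorem count_singleton_le (hG : G.IsAcyclic) {P Q : Finset V} (hT : BiSubtree G P Q)
    (hP : P.Nonempty) {u : V} (hu : u ∈ Q) :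
    4 * countContaining G (P ∪ Q) {u} ≤ 2 * 2 ^ P.card + 2 ^ (P.card + Q.card) := by
  induction hn : P.card + Q.card using Nat.strong_induction_on generalizing P Q with
  | _ n ih =>
  subst hn
  have huA : u ∈ P ∪ Q := Finset.mem_union_right _ hu
  have hP1 := hP.card_pos
  have hQ1 : 0 < Q.card := Finset.card_pos.2 ⟨u, hu⟩
  by_cases hQ : Q.card = 1
  · have h := two_pow_card_mul_countContaining_le (G := G) (Finset.singleton_subset_iff.2 huA)
    rw [hT.card_union, hQ, Finset.card_singleton, pow_succ] at h
    rw [hQ, pow_succ]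
    omega
  obtain ⟨v, w, hvu, hp⟩ := hT.spans.exists_pendant hG (by rw [hT.card_union]; omega) u
  rw [countContaining_singleton_erase hp hvu.symm]
  rcases Finset.mem_union.1 hp.mem with hv | hv
  · -- the leaf lies in the class opposite to `u`
    have hT' := (hT.symm.erase hv (BiSubtree.pendant_symm hp)).symm
    have hE : (P ∪ Q).erase v = P.erase v ∪ Q := by
      rw [Finset.union_comm P Q, hT.symm.erase_union hv, Finset.union_comm]
    have hP2 : 2 ≤ P.card := by
      by_contra hc
      have hP3 : P.card = 1 := by omega
      obtain ⟨d, hd, hdom⟩ := hT.dominates_of_card_eq_one hP3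
      obtain rfl : v = d := Finset.card_le_one.1 hP3.le v hv d hd
      refine hQ (le_antisymm (Finset.card_le_one.2 fun a ha b hb => ?_) hQ1)
      rw [hp.unique a (Finset.mem_union_right _ ha) (hdom a ha),
        hp.unique b (Finset.mem_union_right _ hb) (hdom b hb)]
    have hc := Finset.card_erase_add_one hv
    have h1 := ih _ (by omega) hT' (Finset.card_pos.1 (by omega)) hu rfl
    have h2 := countContaining_pair_le_singleton (G := G) ((P ∪ Q).erase v) u w
    rw [hE] at h2 ⊢
    have h3 := two_pow_card_erase hv
    have h4 := two_pow_add_card_erase hv Q.card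
    rw [add_comm, add_comm Q.card] at h4
    omega
  · have hT' := hT.erase hv hp
    have hwP := hT.nbr_mem hv hp
    have huE : u ∈ Q.erase v := Finset.mem_erase.2 ⟨hvu.symm, hu⟩
    have hc := Finset.card_erase_add_one hv
    have h1 := ih _ (by omega) hT' hP huE rfl
    have h2 := countContaining_pair_le (G := G) (Finset.mem_union_right P huE)
      (Finset.mem_union_left _ hwP) (by rintro rfl; exact hT.notMem_left hu hwP)
    rw [hT'.card_union] at h2
    rw [hT.erase_union hv]
    have h4 := two_pow_add_card_erase hv P.card
    omega

theorem BiSubtree.erase_left {P Q : Finset V} (h : BiSubtree G P Q) {v w : V} (hv : v ∈ P)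
    (hp : PendantAt G (P ∪ Q) v w) : BiSubtree G (P.erase v) Q :=
  (h.symm.erase hv (BiSubtree.pendant_symm hp)).symm

theorem BiSubtree.erase_union_left {P Q : Finset V} (h : BiSubtree G P Q) {v : V} (hv : v ∈ P) :
    (P ∪ Q).erase v = P.erase v ∪ Q := by
  rw [Finset.union_comm P Q, h.symm.erase_union hv, Finset.union_comm]

theorem BiSubtree.nbr_mem_right {P Q : Finset V} (h : BiSubtree G P Q) {v w : V} (hv : v ∈ P)
    (hp : PendantAt G (P ∪ Q) v w) : w ∈ Q :=
  h.symm.nbr_mem hv (BiSubtree.pendant_symm hp)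

theorem two_pow_add_card_erase_left {P : Finset V} {v : V} (hv : v ∈ P) (q : ℕ) :
    2 ^ (P.card + q) = 2 * 2 ^ ((P.erase v).card + q) := by
  rw [add_comm, two_pow_add_card_erase hv, add_comm]

/-- Either `w` itself or the vertex `y` prevents many vertex sets containing `u` and `w` from
spanning a subtree. -/
theorem count_pair_le_of_not_dominates (hG : G.IsAcyclic) {P Q : Finset V}
    (hT : BiSubtree G P Q) {u w y : V} (hu : u ∈ Q) (hw : w ∈ P) (hy : y ∈ P)
    (huy : ¬ G.Adj u y) :
    16 * countContaining G (P ∪ Q) {w, u} ≤ 3 * 2 ^ (P.card + Q.card) := by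
  have hne : ∀ x ∈ P, x ≠ u := by rintro x hx rfl; exact hT.notMem_left hu hx
  rw [← hT.card_union]
  by_cases hyw : y = w
  · subst hyw
    have := countContaining_pair_le_of_not_adj hG hT.spans (Finset.mem_union_right P hu)
      (Finset.mem_union_left Q hw) (hne y hw) (fun h => huy h.symm)
    omega
  · exact countContaining_pair_le_of_far hG hT.spans (Finset.mem_union_right P hu)
      (Finset.mem_union_left Q hw) (Finset.mem_union_left Q hy) (hne w hw) (hne y hy) hyw
      (fun h => huy h.symm) (hT.indep_left y hy w hw)

/-- Bound for a root `u` that is not adjacent to all vertices of the other class. -/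
theorem count_singleton_le_of_not_dominates (hG : G.IsAcyclic) {P Q : Finset V}
    (hT : BiSubtree G P Q) {u y : V} (hu : u ∈ Q) (hy : y ∈ P) (huy : ¬ G.Adj u y) :
    16 * countContaining G (P ∪ Q) {u} ≤ 4 * 2 ^ P.card + 3 * 2 ^ (P.card + Q.card) := by
  induction hn : P.card + Q.card using Nat.strong_induction_on generalizing P Q with
  | _ n ih =>
  subst hn
  have hP1 : 0 < P.card := Finset.card_pos.2 ⟨y, hy⟩
  have hQ1 : 0 < Q.card := Finset.card_pos.2 ⟨u, hu⟩
  by_cases hleaf : ∃ v w, v ∈ P ∧ ¬ G.Adj u v ∧ PendantAt G (P ∪ Q) v w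
  · -- Removing a leaf that is not adjacent to `u`: a subtree containing `u` and this leaf
    -- contains at least two further vertices.
    obtain ⟨v, w, hv, huv, hp⟩ := hleaf
    have hvu : u ≠ v := by rintro rfl; exact hT.notMem_left hu hv
    have hwQ := hT.nbr_mem_right hv hp
    obtain ⟨x, hx, hux⟩ := hT.exists_adj ⟨y, hy⟩ hu
    have hT' := hT.erase_left hv hp
    have hne : (P.erase v).Nonempty :=
      ⟨x, Finset.mem_erase.2 ⟨by rintro rfl; exact huv hux, hx⟩⟩
    have h1 := count_singleton_le hG hT' hne hu
    have h2 := countContaining_pair_le_of_not_adj hG hT'.spans (Finset.mem_union_right _ hu)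
      (Finset.mem_union_right _ hwQ) (by rintro rfl; exact huv hp.adj.symm)
      (hT.indep_right w hwQ u hu)
    rw [hT'.card_union] at h2
    rw [countContaining_singleton_erase hp hvu, hT.erase_union_left hv]
    have h3 := two_pow_card_erase hv
    have h4 := two_pow_add_card_erase_left hv Q.card
    omega
  · push Not at hleaf
    obtain ⟨v, w, hvu, hp⟩ := hT.spans.exists_pendant hG (by rw [hT.card_union]; omega) u
    rw [countContaining_singleton_erase hp hvu.symm]
    rcases Finset.mem_union.1 hp.mem with hv | hv
    · have hc := Finset.card_erase_add_one hv
      have hyv : y ≠ v := by rintro rfl; exact hleaf y w hv huy hp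
      have h1 := ih _ (by omega) (hT.erase_left hv hp) hu (Finset.mem_erase.2 ⟨hyv, hy⟩) rfl
      have h2 := countContaining_pair_le_singleton (G := G) ((P ∪ Q).erase v) u w
      rw [hT.erase_union_left hv] at h2 ⊢
      have h3 := two_pow_card_erase hv
      have h4 := two_pow_add_card_erase_left hv Q.card
      omega
    · have hc := Finset.card_erase_add_one hv
      have huE : u ∈ Q.erase v := Finset.mem_erase.2 ⟨hvu.symm, hu⟩
      have h1 := ih _ (by omega) (hT.erase hv hp) huE hy rfl
      have h2 := count_pair_le_of_not_dominates hG (hT.erase hv hp) huE (hT.nbr_mem hv hp) hy huy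
      rw [hT.erase_union hv]
      have h4 := two_pow_add_card_erase hv P.card
      omega

/-- The bound `count_singleton_le_of_not_dominates` is strict if the root `u` is non-adjacent to at
least two vertices of the other class. -/
theorem count_singleton_lt_of_not_dominates (hG : G.IsAcyclic) {P Q : Finset V}
    (hT : BiSubtree G P Q) {u y z : V} (hu : u ∈ Q) (hy : y ∈ P) (huy : ¬ G.Adj u y) (hz : z ∈ P)
    (huz : ¬ G.Adj u z) (hyz : y ≠ z) :
    16 * countContaining G (P ∪ Q) {u} < 4 * 2 ^ P.card + 3 * 2 ^ (P.card + Q.card) := by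
  induction hn : P.card + Q.card using Nat.strong_induction_on generalizing P Q with
  | _ n ih =>
  subst hn
  have hP1 : 0 < P.card := Finset.card_pos.2 ⟨y, hy⟩
  have hQ1 : 0 < Q.card := Finset.card_pos.2 ⟨u, hu⟩
  by_cases hleaf : ∃ v w, v ∈ P ∧ ¬ G.Adj u v ∧ PendantAt G (P ∪ Q) v w
  · obtain ⟨v, w, hv, huv, hp⟩ := hleaf
    have hvu : u ≠ v := by rintro rfl; exact hT.notMem_left hu hv
    have hwQ := hT.nbr_mem_right hv hp
    have hT' := hT.erase_left hv hp
    have h1 : 16 * countContaining G (P.erase v ∪ Q) {u} ≤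
        4 * 2 ^ (P.erase v).card + 3 * 2 ^ ((P.erase v).card + Q.card) := by
      by_cases hyv : y = v
      · exact count_singleton_le_of_not_dominates hG hT' hu
          (Finset.mem_erase.2 ⟨fun h => hyz (hyv.trans h.symm), hz⟩) huz
      · exact count_singleton_le_of_not_dominates hG hT' hu (Finset.mem_erase.2 ⟨hyv, hy⟩) huy
    have h2 := countContaining_pair_le_of_not_adj hG hT'.spans (Finset.mem_union_right _ hu)
      (Finset.mem_union_right _ hwQ) (by rintro rfl; exact huv hp.adj.symm)
      (hT.indep_right w hwQ u hu)
    rw [hT'.card_union] at h2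
    rw [countContaining_singleton_erase hp hvu, hT.erase_union_left hv]
    have h3 := two_pow_card_erase hv
    have h4 := two_pow_add_card_erase_left hv Q.card
    have h5 : 0 < 2 ^ ((P.erase v).card + Q.card) := by positivity
    omega
  · push Not at hleaf
    obtain ⟨v, w, hvu, hp⟩ := hT.spans.exists_pendant hG (by rw [hT.card_union]; omega) u
    rw [countContaining_singleton_erase hp hvu.symm]
    rcases Finset.mem_union.1 hp.mem with hv | hv
    · have hc := Finset.card_erase_add_one hv
      have hyv : y ≠ v := by rintro rfl; exact hleaf y w hv huy hp
      have hzv : z ≠ v := by rintro rfl; exact hleaf z w hv huz hp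
      have h1 := ih _ (by omega) (hT.erase_left hv hp) hu (Finset.mem_erase.2 ⟨hyv, hy⟩)
        (Finset.mem_erase.2 ⟨hzv, hz⟩) rfl
      have h2 := countContaining_pair_le_singleton (G := G) ((P ∪ Q).erase v) u w
      rw [hT.erase_union_left hv] at h2 ⊢
      have h3 := two_pow_card_erase hv
      have h4 := two_pow_add_card_erase_left hv Q.card
      omega
    · have hc := Finset.card_erase_add_one hv
      have huE : u ∈ Q.erase v := Finset.mem_erase.2 ⟨hvu.symm, hu⟩
      have h1 := ih _ (by omega) (hT.erase hv hp) huE hy hz rfl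
      have h2 := count_pair_le_of_not_dominates hG (hT.erase hv hp) huE (hT.nbr_mem hv hp) hy huy
      rw [hT.erase_union hv]
      have h4 := two_pow_add_card_erase hv P.card
      omega

/-- Bound for an arbitrary root in a tree that is not a double star. -/
theorem count_singleton_le_of_not_isDoubleStar (hG : G.IsAcyclic) {P Q : Finset V}
    (hT : BiSubtree G P Q) (hP : P.Nonempty) (hD : ¬ IsDoubleStar G P Q) {u : V} (hu : u ∈ Q) :
    16 * countContaining G (P ∪ Q) {u} ≤ 12 * 2 ^ P.card + 3 * 2 ^ (P.card + Q.card) := by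
  induction hn : P.card + Q.card using Nat.strong_induction_on generalizing P Q with
  | _ n ih =>
  subst hn
  by_cases hdom : Dominates G u P
  swap
  · unfold Dominates at hdom
    push Not at hdom
    obtain ⟨y, hy, huy⟩ := hdom
    have := count_singleton_le_of_not_dominates hG hT hu hy huy
    omega
  obtain ⟨v, hv, hvu⟩ : ∃ v ∈ Q, v ≠ u := by
    have h := hT.symm.two_le_card_left hP ⟨u, hu⟩ (fun h => hD h.symm)
    exact Finset.exists_mem_ne (by omega) u
  obtain ⟨w, hw, hvw⟩ := hT.exists_adj hP hv
  have hp := hT.pendant_of_dominates hG hdom hv hvu hw hvw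
  have hwu : w ≠ u := by rintro rfl; exact hT.notMem_left hu hw
  obtain ⟨y, hy, hwy⟩ : ∃ y ∈ Q, ¬ G.Adj w y := by
    by_contra! hc
    exact hD ⟨u, w, hu, hw, hdom, hc⟩
  have hyv : y ≠ v := by rintro rfl; exact hwy hvw.symm
  have hyu : y ≠ u := by rintro rfl; exact hwy (hdom w hw).symm
  have hyE : y ∈ Q.erase v := Finset.mem_erase.2 ⟨hyv, hy⟩
  have huE : u ∈ Q.erase v := Finset.mem_erase.2 ⟨hvu.symm, hu⟩
  have hT' := hT.erase hv hp
  have hc := Finset.card_erase_add_one hv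
  have h4 := two_pow_add_card_erase hv P.card
  rw [countContaining_singleton_erase hp hvu.symm, hT.erase_union hv]
  by_cases hD' : IsDoubleStar G P (Q.erase v)
  · -- Then `w` is a leaf at `u` after the removal of `v`.
    obtain ⟨c, d, hcd⟩ := hD'
    have hwd : w ≠ d := by rintro rfl; exact hwy (hcd.dom_d y hyE)
    have hp' : PendantAt G (P ∪ Q.erase v) w u :=
      BiSubtree.pendant_symm (hT'.symm.pendant_of_dominates hG hcd.dom_d hw hwd huE
        (hdom w hw).symm)
    have hne : (P.erase w).Nonempty := ⟨d, Finset.mem_erase.2 ⟨hwd.symm, hcd.d_mem⟩⟩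
    have h1 := count_singleton_le hG (hT'.erase_left hw hp') hne huE
    rw [countContaining_leaf_nbr hp', countContaining_singleton_erase hp' hwu.symm,
      hT'.erase_union_left hw]
    rw [Finset.pair_eq_singleton]
    have h5 := two_pow_card_erase hw
    have h6 := two_pow_add_card_erase_left hw (Q.erase v).card
    omega
  · have h1 := ih _ (by omega) hT' hP hD' huE rfl
    have h2 := countContaining_pair_le_of_far hG hT'.spans (Finset.mem_union_right _ huE)
      (Finset.mem_union_left _ hw) (Finset.mem_union_right _ hyE) hwu hyu
      (by rintro rfl; exact hT.notMem_left hy hw) (hT.indep_right y hy u hu)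
      (fun h => hwy h.symm)
    rw [hT'.card_union] at h2
    omega

/-! ### Exact counts for double stars -/

theorem weightedCount_singleton (w : V → ℕ) (c : V) :
    weightedCount G w {c} ∅ = 2 ^ w c ∧ weightedCount G w {c} {c} = 2 ^ w c := by
  have h0 : ¬ SpansSubtree G (∅ : Finset V) := fun h => by simpa using h.nonempty
  have h1 := spansSubtree_singleton (G := G) c
  have h2 : (∅ : Finset V) ≠ {c} := (Finset.singleton_ne_empty c).symm
  have hpw : ({c} : Finset V).powerset = {∅, {c}} := by
    ext S; simp [Finset.subset_singleton_iff]
  unfold weightedCount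
  simp only [Finset.sum_filter, hpw]
  rw [Finset.sum_pair h2, Finset.sum_pair h2]
  simp [h0, h1]

theorem DoubleStarAt.erase {P Q : Finset V} {c d v : V} (h : DoubleStarAt G P Q c d)
    (hvc : v ≠ c) : DoubleStarAt G P (Q.erase v) c d :=
  ⟨Finset.mem_erase.2 ⟨hvc.symm, h.c_mem⟩, h.d_mem, h.dom_c,
    fun x hx => h.dom_d x (Finset.mem_of_mem_erase hx)⟩

theorem DoubleStarAt.count_eq (hG : G.IsAcyclic) {P Q : Finset V} (hT : BiSubtree G P Q) {c d : V}
    (h : DoubleStarAt G P Q c d) :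
    4 * countContaining G (P ∪ Q) {d, c} = 2 ^ (P.card + Q.card) ∧
    4 * countContaining G (P ∪ Q) {c} = 2 * 2 ^ P.card + 2 ^ (P.card + Q.card) ∧
    4 * countContaining G (P ∪ Q) {d} = 2 * 2 ^ Q.card + 2 ^ (P.card + Q.card) ∧
    4 * countContaining G (P ∪ Q) ∅ + 8 =
      2 ^ (P.card + Q.card) + 2 * 2 ^ P.card + 2 * 2 ^ Q.card + 4 * (P.card + Q.card) := by
  induction hn : P.card + Q.card using Nat.strong_induction_on generalizing P Q c d with
  | _ n ih =>
  subst hn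
  -- the removal of a leaf at `d`; leaves at `c` are treated by exchanging the two classes
  have step : ∀ {P' Q' : Finset V} {c' d' : V}, BiSubtree G P' Q' → DoubleStarAt G P' Q' c' d' →
      P'.card + Q'.card = P.card + Q.card → (∃ v ∈ Q', v ≠ c') →
      4 * countContaining G (P' ∪ Q') {d', c'} = 2 ^ (P'.card + Q'.card) ∧
      4 * countContaining G (P' ∪ Q') {c'} = 2 * 2 ^ P'.card + 2 ^ (P'.card + Q'.card) ∧
      4 * countContaining G (P' ∪ Q') {d'} = 2 * 2 ^ Q'.card + 2 ^ (P'.card + Q'.card) ∧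
      4 * countContaining G (P' ∪ Q') ∅ + 8 = 2 ^ (P'.card + Q'.card) + 2 * 2 ^ P'.card +
        2 * 2 ^ Q'.card + 4 * (P'.card + Q'.card) := by
    rintro P' Q' c' d' hT' h' hcard ⟨v, hv, hvc⟩
    have hp := hT'.pendant_of_dominates hG h'.dom_c hv hvc h'.d_mem (h'.dom_d v hv).symm
    have hvd : d' ≠ v := by rintro rfl; exact hT'.notMem_left hv h'.d_mem
    have hc := Finset.card_erase_add_one hv
    obtain ⟨i1, i2, i3, i4⟩ := ih _ (by omega) (hT'.erase hv hp) (h'.erase hvc) rfl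
    have h1 := countContaining_erase (R := {d', c'}) hp (by simp [hvc, hvd.symm])
    have h2 := countContaining_singleton_erase hp hvc.symm
    have h3 := countContaining_singleton_erase hp hvd
    have h4 := countContaining_empty_erase hp
    rw [Finset.pair_eq_singleton] at h3
    rw [Finset.insert_eq_of_mem (Finset.mem_insert_self d' {c'}),
      if_neg (Finset.insert_ne_empty _ _)] at h1
    rw [hT'.erase_union hv] at h1 h2 h3 h4
    have h5 := two_pow_card_erase hv
    have h6 := two_pow_add_card_erase hv P'.card
    omega
  by_cases hQ : ∃ v ∈ Q, v ≠ c
  · exact step hT h rfl hQ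
  by_cases hP : ∃ v ∈ P, v ≠ d
  · obtain ⟨h1, h2, h3, h4⟩ := step hT.symm h.symm (add_comm _ _) hP
    rw [Finset.union_comm, add_comm Q.card, Finset.pair_comm] at h1
    rw [Finset.union_comm, add_comm Q.card] at h2 h3 h4
    exact ⟨h1, h3, h2, by omega⟩
  · push Not at hP hQ
    obtain rfl : P = {d} := Finset.eq_singleton_iff_unique_mem.2 ⟨h.d_mem, hP⟩
    obtain rfl : Q = {c} := Finset.eq_singleton_iff_unique_mem.2 ⟨h.c_mem, hQ⟩
    have hadj : G.Adj c d := h.dom_c d (by simp)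
    have hp : PendantAt G ({d} ∪ {c}) c d := ⟨by simp, by simp, hadj, by
      intro x hx hcx
      rw [Finset.mem_union, Finset.mem_singleton, Finset.mem_singleton] at hx
      exact hx.resolve_right hcx.ne'⟩
    have hE : ({d} ∪ {c} : Finset V).erase c = {d} := by
      ext x; simp only [Finset.mem_erase, Finset.mem_union, Finset.mem_singleton]
      constructor
      · rintro ⟨h1, h2⟩; exact h2.resolve_right h1
      · rintro rfl; exact ⟨hadj.ne', Or.inl rfl⟩
    have e1 : countContaining G {d} ∅ = 1 := (weightedCount_singleton 0 d).1
    have e2 : countContaining G {d} {d} = 1 := (weightedCount_singleton 0 d).2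
    have h1 := countContaining_leaf_nbr hp
    have h2 := countContaining_leaf hp
    have h3 := countContaining_singleton_erase hp hadj.ne'
    have h4 := countContaining_empty_erase hp
    rw [Finset.pair_eq_singleton] at h3
    rw [Finset.pair_comm] at h1
    rw [hE] at h1 h2 h3 h4
    simp only [Finset.card_singleton]
    omega

/-- The number of subtrees of a tree that becomes a double star after the removal of a leaf
`v ∈ Q` whose neighbour is not a centre. -/
theorem DoubleStarAt.count_add_leaf (hG : G.IsAcyclic) {P Q : Finset V} (hT : BiSubtree G P Q)
    {c d v w : V} (hv : v ∈ Q) (hp : PendantAt G (P ∪ Q) v w)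
    (h : DoubleStarAt G P (Q.erase v) c d) (hwd : w ≠ d) :
    16 * countContaining G (P ∪ Q) ∅ + 16 = 3 * 2 ^ (P.card + Q.card) + 12 * 2 ^ P.card +
      4 * 2 ^ Q.card + 16 * (P.card + Q.card) := by
  have hT' := hT.erase hv hp
  have hw := hT.nbr_mem hv hp
  have hp' : PendantAt G (P ∪ Q.erase v) w c := BiSubtree.pendant_symm
    (hT'.symm.pendant_of_dominates hG h.dom_d hw hwd h.c_mem (h.dom_c w hw).symm)
  have h1 := countContaining_empty_erase hp
  have h2 := countContaining_leaf hp'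
  rw [hT.erase_union hv] at h1
  rw [hT'.erase_union_left hw] at h2
  obtain ⟨-, -, -, e1⟩ := h.count_eq hG hT'
  obtain ⟨-, e2, -, -⟩ := (h.symm.erase hwd).symm.count_eq hG (hT'.erase_left hw hp')
  have a1 := two_pow_card_erase hv
  have a2 := two_pow_card_erase hw
  have a3 := two_pow_add_card_erase hv P.card
  have a4 := two_pow_add_card_erase_left hw (Q.erase v).card
  have a5 := Finset.card_erase_add_one hv
  omega

theorem IsNearDoubleStar.of_forall_ne {P Q : Finset V} {d c y : V} (hd : d ∈ P) (hc : c ∈ Q)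
    (hy : y ∈ P) (hdom : Dominates G d Q) (hcy : ¬ G.Adj c y)
    (h : ∀ x ∈ P, x ≠ y → G.Adj c x) : IsNearDoubleStar G P Q :=
  ⟨d, hd, c, hc, y, hy, hdom, hcy,
    fun x hx => h x (Finset.mem_of_mem_erase hx) (Finset.ne_of_mem_erase hx)⟩

theorem IsNearDoubleStar.count_eq (hG : G.IsAcyclic) {P Q : Finset V} (hT : BiSubtree G P Q)
    (h : IsNearDoubleStar G P Q) :
    16 * countContaining G (P ∪ Q) ∅ + 16 = 3 * 2 ^ (P.card + Q.card) + 12 * 2 ^ Q.card +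
      4 * 2 ^ P.card + 16 * (P.card + Q.card) := by
  obtain ⟨d, hd, c, hc, y, hy, hdom, hcy, hdom'⟩ := h
  have hyd : y ≠ d := by rintro rfl; exact hcy (hdom c hc).symm
  obtain ⟨x, hx, hyx⟩ := hT.symm.exists_adj ⟨c, hc⟩ hy
  have hp := hT.symm.pendant_of_dominates hG hdom hy hyd hx hyx
  have hD : DoubleStarAt G Q (P.erase y) d c :=
    ⟨Finset.mem_erase.2 ⟨hyd.symm, hd⟩, hc, hdom, hdom'⟩
  have := hD.count_add_leaf hG hT.symm hy hp (by rintro rfl; exact hcy hyx.symm)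
  rw [Finset.union_comm, add_comm Q.card] at this
  omega

/-! ### Leaves in the larger class -/

/-- A subtree has one edge fewer than vertices; the edges are counted at their ends in `Q`. -/
theorem BiSubtree.sum_degree (hG : G.IsAcyclic) {P Q : Finset V} (hT : BiSubtree G P Q) :
    ∑ x ∈ Q, (P.filter (G.Adj x)).card + 1 = P.card + Q.card := by
  induction hn : P.card + Q.card using Nat.strong_induction_on generalizing P Q with
  | _ n ih =>
  subst hn
  have hcomm : ∑ x ∈ Q, (P.filter (G.Adj x)).card = ∑ x ∈ P, (Q.filter (G.Adj x)).card := by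
    simp only [Finset.card_filter]
    rw [Finset.sum_comm]
    simp only [G.adj_comm]
  have step : ∀ {P' Q' : Finset V}, BiSubtree G P' Q' → P'.card + Q'.card = P.card + Q.card →
      (∃ v ∈ Q', ∃ w, PendantAt G (P' ∪ Q') v w) →
      ∑ x ∈ Q', (P'.filter (G.Adj x)).card + 1 = P'.card + Q'.card := by
    rintro P' Q' hT' hcard ⟨v, hv, w, hp⟩
    have hc := Finset.card_erase_add_one hv
    have h1 := ih _ (by omega) (hT'.erase hv hp) rfl
    rw [← Finset.add_sum_erase Q' _ hv]
    have h2 : P'.filter (G.Adj v) = {w} := by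
      ext x
      rw [Finset.mem_filter, Finset.mem_singleton]
      constructor
      · rintro ⟨hx, hvx⟩; exact hp.unique x (Finset.mem_union_left _ hx) hvx
      · rintro rfl; exact ⟨hT'.nbr_mem hv hp, hp.adj⟩
    rw [h2, Finset.card_singleton]
    omega
  by_cases h1 : P.card + Q.card = 1
  · have : ∑ x ∈ Q, (P.filter (G.Adj x)).card = 0 := by
      rcases P.eq_empty_or_nonempty with rfl | hP
      · simp
      · have := hP.card_pos
        have hQ : Q = ∅ := Finset.card_eq_zero.1 (by omega)
        simp [hQ]
    omega
  have h2 := hT.spans.nonempty.card_pos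
  rw [hT.card_union] at h2
  obtain ⟨u, -⟩ := hT.spans.nonempty
  obtain ⟨v, w, -, hp⟩ := hT.spans.exists_pendant hG (by rw [hT.card_union]; omega) u
  rcases Finset.mem_union.1 hp.mem with hv | hv
  · rw [hcomm]
    have := step hT.symm (add_comm _ _) ⟨v, hv, w, BiSubtree.pendant_symm hp⟩
    omega
  · exact step hT rfl ⟨v, hv, w, hp⟩

/-- Since the degrees of the vertices of `Q` sum to `|P| + |Q| - 1`, the class `Q` contains at least
`|Q| - |P| + 1` leaves. -/
theorem BiSubtree.card_lt_card_leaves (hG : G.IsAcyclic) {P Q : Finset V} (hT : BiSubtree G P Q)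
    (hP : P.Nonempty) :
    Q.card < P.card + (Q.filter fun v => ∃ w, PendantAt G (P ∪ Q) v w).card := by
  have h1 := hT.sum_degree hG
  have h2 : ∀ x ∈ Q, 2 ≤ (P.filter (G.Adj x)).card +
      if ∃ w, PendantAt G (P ∪ Q) x w then 1 else 0 := by
    intro x hx
    obtain ⟨y, hy, hxy⟩ := hT.exists_adj hP hx
    have h3 : 0 < (P.filter (G.Adj x)).card := Finset.card_pos.2 ⟨y, by simp [hy, hxy]⟩
    split_ifs with h
    · omega
    · have h4 : (P.filter (G.Adj x)).card ≠ 1 := by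
        intro h4
        refine h ⟨y, Finset.mem_union_right _ hx, Finset.mem_union_left _ hy, hxy, ?_⟩
        intro z hz hxz
        have hzP := (Finset.mem_union.1 hz).resolve_right fun hz => hT.indep_right x hx z hz hxz
        exact Finset.card_le_one.1 h4.le z (by simp [hzP, hxz]) y (by simp [hy, hxy])
      omega
  have h3 := Finset.sum_le_sum h2
  rw [Finset.sum_add_distrib, ← Finset.card_filter, Finset.sum_const, smul_eq_mul] at h3
  omega

theorem BiSubtree.exists_leaves (hG : G.IsAcyclic) {P Q : Finset V} (hT : BiSubtree G P Q)
    (hP : P.Nonempty) : ∃ L ⊆ Q, Q.card < P.card + L.card ∧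
      ∀ v ∈ L, ∃ w, PendantAt G (P ∪ Q) v w :=
  ⟨_, Finset.filter_subset _ Q, hT.card_lt_card_leaves hG hP,
    fun _ hv => (Finset.mem_filter.1 hv).2⟩

theorem BiSubtree.exists_leaf (hG : G.IsAcyclic) {P Q : Finset V} (hT : BiSubtree G P Q)
    (hP : P.Nonempty) (hPQ : P.card ≤ Q.card) : ∃ v ∈ Q, ∃ w ∈ P, PendantAt G (P ∪ Q) v w := by
  have h := hT.card_lt_card_leaves hG hP
  obtain ⟨v, hv⟩ := Finset.card_pos.1
    (show 0 < (Q.filter fun v => ∃ w, PendantAt G (P ∪ Q) v w).card by omega)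
  obtain ⟨hvQ, w, hw⟩ := Finset.mem_filter.1 hv
  exact ⟨v, hvQ, w, hT.nbr_mem hvQ hw, hw⟩

/-! ### The maximum over trees that are not double stars -/

theorem DoubleStarAt.isNearDoubleStar_of_erase {P Q : Finset V} {c d v w : V} (hv : v ∈ Q)
    (hp : PendantAt G (P ∪ Q) v w) (h : DoubleStarAt G P (Q.erase v) c d) (hwd : w ≠ d) :
    IsNearDoubleStar G Q P :=
  ⟨c, Finset.mem_of_mem_erase h.c_mem, d, h.d_mem, v, hv, h.dom_c,
    fun hdv => hwd (hp.unique d (Finset.mem_union_left _ h.d_mem) hdv.symm).symm, h.dom_d⟩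

theorem DoubleStarAt.of_erase {P Q : Finset V} {c d v : V} (hdv : G.Adj d v)
    (h : DoubleStarAt G P (Q.erase v) c d) : DoubleStarAt G P Q c d :=
  ⟨Finset.mem_of_mem_erase h.c_mem, h.d_mem, h.dom_c, fun x hx => by
    by_cases hxv : x = v
    · exact hxv ▸ hdv
    · exact h.dom_d x (Finset.mem_erase.2 ⟨hxv, hx⟩)⟩

/-- The second largest subtree number for a class of size two. Deleting a leaf in `Q` keeps the
class `P`, so that the induction runs over `|Q|`. -/
theorem count_le_of_card_eq_two (hG : G.IsAcyclic) {P Q : Finset V} (hT : BiSubtree G P Q)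
    (hP : P.card = 2) (hQ : 2 ≤ Q.card) (hD : ¬ IsDoubleStar G P Q) :
    4 * countContaining G (P ∪ Q) ∅ ≤ 2 ^ (2 + Q.card) + 4 * (2 + Q.card) + 8 ∧
    (4 * countContaining G (P ∪ Q) ∅ = 2 ^ (2 + Q.card) + 4 * (2 + Q.card) + 8 →
      IsNearDoubleStar G Q P) := by
  induction hn : Q.card using Nat.strong_induction_on generalizing Q with
  | _ n ih =>
  subst hn
  have hPne : P.Nonempty := Finset.card_pos.1 (by omega)
  obtain ⟨v, hv, w, hw, hp⟩ := hT.exists_leaf hG hPne (by omega)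
  have hT' := hT.erase hv hp
  have hc := Finset.card_erase_add_one hv
  have e4 : 2 ^ (2 + Q.card) = 4 * 2 ^ Q.card := by rw [pow_add]; norm_num
  by_cases hD' : IsDoubleStar G P (Q.erase v)
  · obtain ⟨c, d, hcd⟩ := hD'
    have hwd : w ≠ d := by
      rintro rfl
      exact hD ⟨c, w, hcd.of_erase hp.adj.symm⟩
    have h1 := hcd.count_add_leaf hG hT hv hp hwd
    rw [hP] at h1
    exact ⟨by omega, fun _ => hcd.isNearDoubleStar_of_erase hv hp hwd⟩
  · have hQ' : 2 ≤ (Q.erase v).card := hT'.symm.two_le_card_left hPne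
      (Finset.card_pos.1 (by omega)) fun h => hD' h.symm
    obtain ⟨i1, i2⟩ := ih _ (by omega) hT' hQ' hD' rfl
    -- If `w` were adjacent to all of `Q` but `v`, then a neighbour of the other vertex of `P`
    -- would be adjacent to both vertices of `P`.
    obtain ⟨y, hy, hwy⟩ : ∃ y ∈ Q.erase v, ¬ G.Adj w y := by
      by_contra! hdom
      obtain ⟨w', hw', hne⟩ := Finset.exists_mem_ne (by omega : 1 < P.card) w
      obtain ⟨z, hz, hwz⟩ := hT'.symm.exists_adj (Finset.card_pos.1 (by omega)) hw'
      have hPe : P = {w', w} := (Finset.eq_of_subset_of_card_le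
        (by simp [Finset.insert_subset_iff, hw, hw']) (by rw [Finset.card_pair hne, hP])).symm
      refine hD' ⟨z, w, hz, hw, fun x hx => ?_, hdom⟩
      rw [hPe, Finset.mem_insert, Finset.mem_singleton] at hx
      rcases hx with rfl | rfl
      · exact hwz.symm
      · exact (hdom z hz).symm
    have h1 := countContaining_empty_erase hp
    have h2 := count_singleton_le_of_not_dominates hG hT'.symm hw hy hwy
    rw [hT.erase_union hv] at h1
    rw [Finset.union_comm, hP, add_comm (Q.erase v).card 2] at h2
    have a1 := two_pow_card_erase hv
    have a2 := two_pow_add_card_erase hv 2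
    have a3 : 2 ^ (2 + (Q.erase v).card) = 4 * 2 ^ (Q.erase v).card := by rw [pow_add]; norm_num
    refine ⟨by omega, fun heq => ?_⟩
    obtain ⟨d, hd, -, -, -, -, hdom, -, -⟩ := i2 (by omega)
    refine ⟨d, Finset.mem_of_mem_erase hd, w, hw, y, Finset.mem_of_mem_erase hy, hdom, hwy, ?_⟩
    intro x hx
    by_contra hwx
    have hxv : x ≠ v := by rintro rfl; exact hwx hp.adj.symm
    have h3 := count_singleton_lt_of_not_dominates hG hT'.symm hw
      (Finset.mem_erase.2 ⟨hxv, Finset.mem_of_mem_erase hx⟩) hwx hy hwy (Finset.ne_of_mem_erase hx)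
    rw [Finset.union_comm, hP, add_comm (Q.erase v).card 2] at h3
    omega

/-- The second largest subtree number for classes with at least three vertices. For classes of equal
size, either of them may play the role of the class of size `p` in `B(p, p)`. -/
theorem count_le_of_three_le_card (hG : G.IsAcyclic) {P Q : Finset V} (hT : BiSubtree G P Q)
    (hP : 3 ≤ P.card) (hPQ : P.card ≤ Q.card) (hD : ¬ IsDoubleStar G P Q) :
    16 * countContaining G (P ∪ Q) ∅ + 16 ≤ 3 * 2 ^ (P.card + Q.card) + 12 * 2 ^ Q.card +
      4 * 2 ^ P.card + 16 * (P.card + Q.card) ∧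
    (16 * countContaining G (P ∪ Q) ∅ + 16 = 3 * 2 ^ (P.card + Q.card) + 12 * 2 ^ Q.card +
      4 * 2 ^ P.card + 16 * (P.card + Q.card) →
      IsNearDoubleStar G P Q ∨ (P.card = Q.card ∧ IsNearDoubleStar G Q P)) := by
  induction hn : P.card + Q.card using Nat.strong_induction_on generalizing P Q with
  | _ n ih =>
  subst hn
  have hPne : P.Nonempty := Finset.card_pos.1 (by omega)
  have hQne : Q.Nonempty := Finset.card_pos.1 (by omega)
  obtain ⟨v, hv, w, hw, hp⟩ := hT.exists_leaf hG hPne hPQ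
  rcases hPQ.lt_or_eq with hlt | heq
  · have hT' := hT.erase hv hp
    have hc := Finset.card_erase_add_one hv
    have hpow : 2 ^ P.card < 2 ^ Q.card := Nat.pow_lt_pow_right (by norm_num) hlt
    by_cases hD' : IsDoubleStar G P (Q.erase v)
    · obtain ⟨c, d, hcd⟩ := hD'
      have hwd : w ≠ d := by
        rintro rfl
        exact hD ⟨c, w, hcd.of_erase hp.adj.symm⟩
      have h1 := hcd.count_add_leaf hG hT hv hp hwd
      exact ⟨by omega, fun h => by omega⟩
    · obtain ⟨i1, i2⟩ := ih _ (by omega) hT' hP (by omega) hD' rfl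
      have hEne : (Q.erase v).Nonempty := Finset.card_pos.1 (by omega)
      have h1 := countContaining_empty_erase hp
      have h2 := count_singleton_le_of_not_isDoubleStar hG hT'.symm hEne
        (fun h => hD' h.symm) hw
      rw [hT.erase_union hv] at h1
      rw [Finset.union_comm, add_comm (Q.erase v).card] at h2
      have a1 := two_pow_card_erase hv
      have a2 := two_pow_add_card_erase hv P.card
      have a3 : 0 < 2 ^ (Q.erase v).card := by positivity
      refine ⟨by omega, fun h => Or.inl ?_⟩
      have hdomw : Dominates G w (Q.erase v) := by
        intro y hy
        by_contra hwy
        have h3 := count_singleton_le_of_not_dominates hG hT'.symm hw hy hwy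
        rw [Finset.union_comm, add_comm (Q.erase v).card] at h3
        omega
      rcases i2 (by omega) with ⟨d, hd, c, hcE, y, hy, hdom, hcy, hdom'⟩ |
        ⟨-, c, hcE, -, -, -, -, hdomc, -⟩
      · -- As `w` and `d` both dominate `Q` without `v`, they coincide.
        obtain ⟨b, hb, hbc⟩ := Finset.exists_mem_ne (by omega : 1 < (Q.erase v).card) c
        obtain rfl : w = d := hG.eq_of_common_adj hbc (hdomw b hb).symm (hdomw c hcE)
          (hdom b hb).symm (hdom c hcE)
        refine ⟨w, hw, c, Finset.mem_of_mem_erase hcE, y, hy, fun x hx => ?_, hcy, hdom'⟩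
        by_cases hxv : x = v
        · exact hxv ▸ hp.adj.symm
        · exact hdom x (Finset.mem_erase.2 ⟨hxv, hx⟩)
      · exact absurd ⟨c, w, hcE, hw, hdomc, hdomw⟩ hD'
  · -- Both classes have the same size, so that they may be exchanged.
    have step : ∀ {P' Q' : Finset V}, BiSubtree G P' Q' → ¬ IsDoubleStar G P' Q' →
        P'.card = P.card → Q'.card = P.card →
        (∃ v ∈ P', ∃ w ∈ Q', PendantAt G (P' ∪ Q') v w ∧ ¬ Dominates G w P') →
        16 * countContaining G (P' ∪ Q') ∅ + 16 ≤ 3 * 2 ^ (P'.card + Q'.card) +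
          12 * 2 ^ Q'.card + 4 * 2 ^ P'.card + 16 * (P'.card + Q'.card) ∧
        (16 * countContaining G (P' ∪ Q') ∅ + 16 = 3 * 2 ^ (P'.card + Q'.card) +
          12 * 2 ^ Q'.card + 4 * 2 ^ P'.card + 16 * (P'.card + Q'.card) →
          IsNearDoubleStar G P' Q') := by
      rintro P' Q' hB hnD hc1 hc2 ⟨v, hv, w, hw, hp, hndom⟩
      have hB' := hB.erase_left hv hp
      have hc := Finset.card_erase_add_one hv
      have a1 := two_pow_card_erase hv
      have a2 := two_pow_add_card_erase_left hv Q'.card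
      by_cases hD' : IsDoubleStar G (P'.erase v) Q'
      · obtain ⟨c, d, hcd⟩ := hD'
        have hwc : w ≠ c := by
          rintro rfl
          exact hnD ⟨w, d, (hcd.symm.of_erase hp.adj.symm).symm⟩
        have hp' := BiSubtree.pendant_symm hp
        have h1 := hcd.symm.count_add_leaf hG hB.symm hv hp' hwc
        rw [Finset.union_comm, add_comm Q'.card] at h1
        exact ⟨by omega, fun _ => hcd.symm.isNearDoubleStar_of_erase hv hp' hwc⟩
      · obtain ⟨y, hy, hwy⟩ : ∃ y ∈ P', ¬ G.Adj w y := by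
          unfold Dominates at hndom
          push Not at hndom
          exact hndom
        have hyE : y ∈ P'.erase v :=
          Finset.mem_erase.2 ⟨by rintro rfl; exact hwy hp.adj.symm, hy⟩
        have h1 := countContaining_empty_erase hp
        have h2 := count_singleton_le_of_not_dominates hG hB' hw hyE hwy
        rw [hB.erase_union_left hv] at h1
        by_cases hP3 : 3 ≤ (P'.erase v).card
        · obtain ⟨i1, i2⟩ := ih _ (by omega) hB' hP3 (by omega) hD' rfl
          refine ⟨by omega, fun h => ?_⟩
          rcases i2 (by omega) with ⟨d, hd, -, -, -, -, hdom, -, -⟩ | ⟨hcard, -⟩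
          swap
          · omega
          refine ⟨d, Finset.mem_of_mem_erase hd, w, hw, y, hy, hdom, hwy, fun x hx => ?_⟩
          by_contra hwx
          have hxv : x ≠ v := by rintro rfl; exact hwx hp.adj.symm
          have h3 := count_singleton_lt_of_not_dominates hG hB' hw
            (Finset.mem_erase.2 ⟨hxv, Finset.mem_of_mem_erase hx⟩) hwx hyE hwy
            (Finset.ne_of_mem_erase hx)
          omega
        · have hP2 : (P'.erase v).card = 2 := by omega
          have hQ3 : Q'.card = 3 := by omega
          have hP3' : P'.card = 3 := by omega
          obtain ⟨i1, -⟩ := count_le_of_card_eq_two hG hB' hP2 (by omega) hD'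
          rw [hP2, hQ3] at h2
          rw [hQ3] at i1
          rw [hP3', hQ3]
          norm_num at h2 i1 ⊢
          exact ⟨by omega, fun h => by omega⟩
    by_cases hwdom : Dominates G w Q
    · obtain ⟨v', hv', w', hw', hp'⟩ := hT.symm.exists_leaf hG hQne heq.ge
      have hnd : ¬ Dominates G w' P := fun h => hD ⟨w', w, hw', hw, h, hwdom⟩
      obtain ⟨h1, h2⟩ := step hT hD rfl heq.symm
        ⟨v', hv', w', hw', BiSubtree.pendant_symm hp', hnd⟩
      exact ⟨h1, fun h => Or.inl (h2 h)⟩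
    · obtain ⟨h1, h2⟩ := step hT.symm (fun h => hD h.symm) heq.symm rfl
        ⟨v, hv, w, hw, BiSubtree.pendant_symm hp, hwdom⟩
      rw [Finset.union_comm, add_comm Q.card] at h1 h2
      rw [heq] at h1 h2 ⊢
      exact ⟨by omega, fun h => Or.inr ⟨rfl, h2 (by omega)⟩⟩

/-! ### The minimum over trees with prescribed leaves -/

theorem weightedCount_congr {w w' : V → ℕ} {A : Finset V} (h : ∀ x ∈ A, w x = w' x)
    (R : Finset V) : weightedCount G w A R = weightedCount G w' A R := by
  unfold weightedCount
  refine Finset.sum_congr rfl fun S hS => ?_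
  rw [Finset.mem_filter, Finset.mem_powerset] at hS
  rw [Finset.sum_congr rfl fun x hx => h x (hS.1 hx)]

/-- Contraction of the edge between a leaf `v` and its neighbour `u`, which passes the weight of
`v` on to `u`. -/
theorem weightedCount_contract (w : V → ℕ) {A : Finset V} {v u : V} (hp : PendantAt G A v u) :
    weightedCount G w A ∅ =
      weightedCount G (Function.update w u (w u + w v)) (A.erase v) ∅ +
        weightedCount G w (A.erase v) {u} + 2 ^ w v := by
  have h1 := weightedCount_erase w hp (Finset.notMem_empty v)
  have h2 := weightedCount_update (G := G) w (A.erase v) ∅ u (w v)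
  simp only [if_true, insert_empty_eq] at h1 h2
  omega

/-- A subtree `A` contains at least `|A|` subtrees through `u`, and more if `u` is not a leaf. -/
theorem card_le_countContaining_singleton (hG : G.IsAcyclic) {A : Finset V}
    (hA : SpansSubtree G A) {u : V} (hu : u ∈ A) :
    A.card ≤ countContaining G A {u} ∧
    (2 ≤ A.card → (∀ t, ¬ PendantAt G A u t) → A.card + 1 ≤ countContaining G A {u}) := by
  induction hn : A.card using Nat.strong_induction_on generalizing A with
  | _ n ih =>
  subst hn
  by_cases h1 : A.card ≤ 1
  · have h2 : A = {u} :=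
      (Finset.eq_of_subset_of_card_le (by simpa using hu) (by simpa using h1)).symm
    refine ⟨?_, fun h => absurd h (by omega)⟩
    rw [h2, countContaining, (weightedCount_singleton 0 u).2]
    simp
  obtain ⟨v, t, hvu, hp⟩ := hA.exists_pendant hG (by omega) u
  have hsplit := countContaining_split (G := G) A {u} v
  have hc := Finset.card_erase_add_one hp.mem
  obtain ⟨i1, -⟩ := ih _ (by omega) (hA.erase hp) (Finset.mem_erase.2 ⟨hvu.symm, hu⟩) rfl
  have hAmem : A ∈ A.powerset.filter fun S => SpansSubtree G S ∧ {v, u} ⊆ S := by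
    simp [Finset.insert_subset_iff, hA, hu, hp.mem]
  constructor
  · have h2 : 0 < countContaining G A {v, u} := by
      rw [countContaining_eq_card]
      exact Finset.card_pos.2 ⟨A, hAmem⟩
    omega
  · intro _ hnp
    -- besides `A` itself, deleting a second leaf gives a subtree containing `u` and `v`
    obtain ⟨v', t', hvv', hp'⟩ := hA.exists_pendant hG (by omega) v
    have hvu' : v' ≠ u := by rintro rfl; exact hnp t' hp'
    have h2 : 1 < countContaining G A {v, u} := by
      rw [countContaining_eq_card]
      refine Finset.one_lt_card.2 ⟨A, hAmem, A.erase v', ?_, ?_⟩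
      · simp [Finset.insert_subset_iff, Finset.erase_subset, hA.erase hp', hu, hp.mem, hvv'.symm,
          hvu'.symm]
      · exact fun h => Finset.notMem_erase v' A (h ▸ hp'.mem)
    omega

/-- The subtrees through `u` include `A` and `{u}`; all others have weight at least one. -/
theorem le_weightedCount_singleton (hG : G.IsAcyclic) {A : Finset V} (hA : SpansSubtree G A)
    (hA2 : 2 ≤ A.card) {u : V} (hu : u ∈ A) (w : V → ℕ) :
    2 ^ (∑ x ∈ A, w x) + 2 ^ w u + A.card ≤ weightedCount G w A {u} + 2 ∧
    ((∀ t, ¬ PendantAt G A u t) →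
      2 ^ (∑ x ∈ A, w x) + 2 ^ w u + A.card + 1 ≤ weightedCount G w A {u} + 2) := by
  obtain ⟨h1, h2⟩ := card_le_countContaining_singleton hG hA hu
  have hne : A ≠ {u} := by rintro rfl; simp at hA2
  have key : 2 ^ (∑ x ∈ A, w x) + 2 ^ w u + countContaining G A {u} ≤
      weightedCount G w A {u} + 2 := by
    rw [countContaining_eq_card]
    unfold weightedCount
    set F := A.powerset.filter fun S => SpansSubtree G S ∧ {u} ⊆ S with hF
    have hAF : A ∈ F := by simp [hF, hA, hu]
    have huF : {u} ∈ F.erase A := by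
      simp [hF, hne.symm, hu, spansSubtree_singleton]
    rw [← Finset.add_sum_erase F _ hAF, ← Finset.add_sum_erase (F.erase A) _ huF]
    rw [← Finset.card_erase_add_one hAF, ← Finset.card_erase_add_one huF]
    have h3 : ((F.erase A).erase {u}).card ≤
        ∑ S ∈ (F.erase A).erase {u}, 2 ^ ∑ x ∈ S, w x := by
      rw [Finset.card_eq_sum_ones]
      exact Finset.sum_le_sum fun S _ => Nat.one_le_two_pow
    rw [Finset.sum_singleton]
    omega
  exact ⟨by omega, fun h => by have := h2 hA2 h; omega⟩

/-- The sum `2 ^ s + 2 ^ t` for fixed `s + t` is smallest if `s` and `t` are as equal as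
possible. -/
theorem two_pow_add_two_pow_le {a b s t : ℕ} (hab : a ≤ b) (hba : b ≤ a + 1) (h : s + t = a + b) :
    2 ^ a + 2 ^ b ≤ 2 ^ s + 2 ^ t ∧
    (2 ^ a + 2 ^ b = 2 ^ s + 2 ^ t → (s = a ∧ t = b) ∨ (s = b ∧ t = a)) := by
  wlog hst : s ≤ t generalizing s t
  · obtain ⟨h1, h2⟩ := this (by omega) (by omega : t ≤ s)
    exact ⟨by omega, fun h => by have := h2 (by omega); omega⟩
  have hsa : s ≤ a := by omega
  rcases hsa.eq_or_lt with rfl | hlt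
  · obtain rfl : t = b := by omega
    exact ⟨le_rfl, fun _ => Or.inl ⟨rfl, rfl⟩⟩
  · have h1 : 2 ^ (b + 1) ≤ 2 ^ t := Nat.pow_le_pow_right (by norm_num) (by omega)
    have h2 : 2 ^ a ≤ 2 ^ b := Nat.pow_le_pow_right (by norm_num) hab
    have h3 : 0 < 2 ^ s := by positivity
    rw [pow_succ] at h1
    exact ⟨by omega, fun h => by omega⟩

/-- Prepending a vertex to an induced path. -/
theorem exists_pathGraph_cons {m : ℕ} (f : SimpleGraph.pathGraph (m + 1) ↪g G) {v : V}
    (hv : PendantAt G (insert v (Finset.univ.image f)) v (f 0)) (hvf : ∀ i, f i ≠ v) :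
    ∃ g : SimpleGraph.pathGraph (m + 2) ↪g G, g 0 = v ∧ ∀ i : Fin (m + 1), g i.succ = f i := by
  refine ⟨⟨⟨Fin.cons v f, ?_⟩, ?_⟩, rfl, fun i => rfl⟩
  · rw [Fin.cons_injective_iff]
    exact ⟨by rintro ⟨i, hi⟩; exact hvf i hi, f.injective⟩
  · have key : ∀ j : Fin (m + 1), G.Adj v (f j) ↔ (SimpleGraph.pathGraph (m + 2)).Adj 0 j.succ := by
      intro j
      rw [SimpleGraph.pathGraph_adj]
      constructor
      · intro h
        have h1 := f.injective (hv.unique (f j) (by simp) h)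
        subst h1
        simp
      · intro h
        have : j = 0 := by
          ext; simp at h ⊢; exact h
        exact this ▸ hv.adj
    intro i j
    refine Fin.cases ?_ (fun i => ?_) i <;> refine Fin.cases ?_ (fun j => ?_) j
    · simp
    · exact key j
    · rw [SimpleGraph.adj_comm, SimpleGraph.adj_comm _ i.succ]; exact key i
    · refine (f.map_adj_iff (v := i) (w := j)).trans ?_
      simp [SimpleGraph.pathGraph_adj]

theorem exists_pathGraph_rev {m : ℕ} (f : SimpleGraph.pathGraph (m + 1) ↪g G) :
    ∃ g : SimpleGraph.pathGraph (m + 1) ↪g G, ∀ i, g i = f i.rev := by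
  refine ⟨⟨⟨fun i => f i.rev, f.injective.comp Fin.rev_injective⟩, ?_⟩, fun i => rfl⟩
  intro i j
  refine (f.map_adj_iff (v := i.rev) (w := j.rev)).trans ?_
  simp only [SimpleGraph.pathGraph_adj, Fin.val_rev]
  omega

/-- A leaf of an induced path is one of its ends. -/
theorem eq_zero_or_eq_last_of_pendantAt {m : ℕ} (f : SimpleGraph.pathGraph (m + 1) ↪g G)
    {A : Finset V} (hA : ∀ i, f i ∈ A) {i : Fin (m + 1)} {t : V} (hp : PendantAt G A (f i) t) :
    i = 0 ∨ i = Fin.last m := by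
  by_contra! h
  obtain ⟨h0, hl⟩ := h
  have h0' : 0 < i.val := Nat.pos_of_ne_zero fun h => h0 (Fin.ext h)
  have hl' : i.val < m := lt_of_le_of_ne (Nat.lt_succ_iff.1 i.2) fun h => hl (Fin.ext h)
  have e1 := hp.unique (f ⟨i.val - 1, by omega⟩) (hA _)
    (f.map_adj_iff.2 (SimpleGraph.pathGraph_adj.2 (Or.inr (by simp; omega))))
  have e2 := hp.unique (f ⟨i.val + 1, by omega⟩) (hA _)
    (f.map_adj_iff.2 (SimpleGraph.pathGraph_adj.2 (Or.inl rfl)))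
  have := f.injective (e1.trans e2.symm)
  simp only [Fin.mk.injEq] at this
  omega

/-- The path `f` is weighted only at its ends, with weights `a` and `b` in some order. For a path
with a single vertex nothing is required. -/
def EndWeights {m : ℕ} (f : Fin (m + 1) → V) (w : V → ℕ) (a b : ℕ) : Prop :=
  0 < m → (∀ i, i ≠ 0 → i ≠ Fin.last m → w (f i) = 0) ∧
    ((w (f 0) = a ∧ w (f (Fin.last m)) = b) ∨ (w (f 0) = b ∧ w (f (Fin.last m)) = a))

/-- Among the weighted subtrees with `m + 1` vertices and total weight `a + b`, where `a` and `b`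
are as equal as possible, the paths weighted at their ends have the smallest weighted count. The
induction contracts the edge at a leaf. -/
theorem le_weightedCount (hG : G.IsAcyclic) {a b : ℕ} (hab : a ≤ b) (hba : b ≤ a + 1) (m : ℕ)
    {A : Finset V} (hA : SpansSubtree G A) (hm : A.card = m + 1) (w : V → ℕ)
    (hw : ∑ x ∈ A, w x = a + b) :
    2 ^ (a + b) + m * (2 ^ a + 2 ^ b) + m.choose 2 ≤ weightedCount G w A ∅ ∧
    (weightedCount G w A ∅ = 2 ^ (a + b) + m * (2 ^ a + 2 ^ b) + m.choose 2 →
      ∃ f : SimpleGraph.pathGraph (m + 1) ↪g G, Finset.univ.image f = A ∧ EndWeights f w a b) := by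
  induction m generalizing A w with
  | zero =>
    obtain ⟨c, rfl⟩ := Finset.card_eq_one.1 hm
    have hsub : Subsingleton (Fin (0 + 1)) := inferInstanceAs (Subsingleton (Fin 1))
    rw [(weightedCount_singleton w c).1, ← hw]
    refine ⟨by simp, fun _ => ⟨⟨⟨fun _ => c, fun i j _ => Subsingleton.elim i j⟩, ?_⟩, ?_, ?_⟩⟩
    · intro i j
      rw [Subsingleton.elim i j]
      simp
    · exact Finset.image_const Finset.univ_nonempty c
    · intro h
      exact absurd h (lt_irrefl 0)
  | succ m ih =>
    obtain ⟨x, -⟩ := hA.nonempty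
    obtain ⟨v, u, -, hp⟩ := hA.exists_pendant hG (by omega) x
    have hA' := hA.erase hp
    have hu := hp.nbr_mem_erase
    have hc : (A.erase v).card = m + 1 := by have := Finset.card_erase_add_one hp.mem; omega
    have hwv := Finset.add_sum_erase A w hp.mem
    have hw' : ∑ x ∈ A.erase v, Function.update w u (w u + w v) x = a + b := by
      rw [Finset.sum_update_of_mem hu, Finset.sdiff_singleton_eq_erase]
      have := Finset.add_sum_erase (A.erase v) w hu
      omega
    obtain ⟨i1, i2⟩ := ih hA' hc _ hw'
    have hcon := weightedCount_contract w hp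
    obtain ⟨t1, t2⟩ := two_pow_add_two_pow_le (s := w v) (t := ∑ x ∈ A.erase v, w x) hab hba
      (by omega)
    have hchoose : (m + 1).choose 2 = m + m.choose 2 := by
      rw [Nat.choose_succ_succ' m 1, Nat.choose_one_right]
    rw [hchoose, Nat.succ_mul m]
    rcases Nat.eq_zero_or_pos m with rfl | hmpos
    · have hAu : A.erase v = {u} :=
        (Finset.eq_of_subset_of_card_le (by simpa using hu) (by simp [hc])).symm
      have h3 : weightedCount G w (A.erase v) {u} = 2 ^ w u := by
        rw [hAu, (weightedCount_singleton w u).2]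
      have h4 : ∑ x ∈ A.erase v, w x = w u := by rw [hAu]; simp
      rw [h4] at t1 t2
      refine ⟨by omega, fun heq => ?_⟩
      obtain ⟨f, hf, -⟩ := i2 (by omega)
      have hfu : f 0 = u := by
        have : f 0 ∈ A.erase v := hf ▸ (by simp)
        rw [hAu] at this
        simpa using this
      have hins : insert v (Finset.univ.image f) = A := by rw [hf, Finset.insert_erase hp.mem]
      obtain ⟨g, hg0, hg⟩ := exists_pathGraph_cons f (v := v) (by rw [hins, hfu]; exact hp)
        (fun i h => Finset.notMem_erase v A
          (hf ▸ h ▸ Finset.mem_image_of_mem f (Finset.mem_univ i)))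
      refine ⟨g, ?_, fun _ => ⟨fun i hi hi' => ?_, ?_⟩⟩
      · rw [← hins]
        ext y
        simp [Fin.exists_fin_succ, hg0, hg, eq_comm]
      · exfalso; revert i; decide
      · have h5 : g (Fin.last 1) = u := (hg 0).trans hfu
        rw [hg0, h5]
        exact t2 (by omega)
    · obtain ⟨l1, l2⟩ := le_weightedCount_singleton hG hA' (by omega) hu w
      have hpos : 0 < 2 ^ w u := by positivity
      refine ⟨by omega, fun heq => ?_⟩
      obtain ⟨f, hf, hE⟩ := i2 (by omega)
      have hwu : w u = 0 := by
        by_contra h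
        have : 2 ^ 1 ≤ 2 ^ w u := Nat.pow_le_pow_right (by norm_num) (by omega)
        omega
      obtain ⟨t, ht⟩ : ∃ t, PendantAt G (A.erase v) u t := by
        by_contra! h
        have := l2 h
        omega
      -- `u` is an end of the path, and the path may be reversed
      obtain ⟨f, hf, hE, hfu⟩ : ∃ f : SimpleGraph.pathGraph (m + 1) ↪g G,
          Finset.univ.image f = A.erase v ∧
          EndWeights f (Function.update w u (w u + w v)) a b ∧ f 0 = u := by
        obtain ⟨i, -, hi⟩ := Finset.mem_image.1 (hf ▸ hu)
        subst hi
        rcases eq_zero_or_eq_last_of_pendantAt f (fun j => hf ▸ (by simp)) ht with rfl | rfl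
        · exact ⟨f, hf, hE, rfl⟩
        · obtain ⟨g, hg⟩ := exists_pathGraph_rev f
          refine ⟨g, ?_, ?_, by simp [hg]⟩
          · rw [← hf]
            ext y
            simp only [Finset.mem_image, Finset.mem_univ, true_and, hg]
            exact ⟨fun ⟨i, hi⟩ => ⟨_, hi⟩, fun ⟨i, hi⟩ => ⟨i.rev, by simpa using hi⟩⟩
          · intro h
            obtain ⟨e1, e2⟩ := hE h
            refine ⟨fun i hi hi' => ?_, ?_⟩
            · rw [hg]
              exact e1 _ (by simpa [Fin.rev_eq_iff] using hi') (by simpa [Fin.rev_eq_iff] using hi)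
            · simp only [hg, Fin.rev_zero, Fin.rev_last]
              tauto
      obtain ⟨e1, e2⟩ := hE hmpos
      have hins : insert v (Finset.univ.image f) = A := by rw [hf, Finset.insert_erase hp.mem]
      obtain ⟨g, hg0, hg⟩ := exists_pathGraph_cons f (v := v) (by rw [hins, hfu]; exact hp)
        (fun i h => Finset.notMem_erase v A
          (hf ▸ h ▸ Finset.mem_image_of_mem f (Finset.mem_univ i)))
      refine ⟨g, ?_, fun _ => ⟨fun i => ?_, ?_⟩⟩
      · rw [← hins]
        ext y
        simp [Fin.exists_fin_succ, hg0, hg, eq_comm]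
      · refine Fin.cases (fun h => absurd rfl h) (fun i => ?_) i
        intro _ hi
        rw [hg]
        by_cases hi0 : i = 0
        · rw [hi0, hfu, hwu]
        · have h6 := e1 i hi0 (fun h => hi (by rw [h, Fin.succ_last]))
          rwa [Function.update_of_ne (fun h => hi0 (f.injective (h.trans hfu.symm)))] at h6
      · have hl : f (Fin.last m) ≠ u := fun h => by
          have := f.injective (h.trans hfu.symm)
          rw [Fin.ext_iff] at this
          simp at this
          omega
        rw [hg0, ← Fin.succ_last, hg]
        rw [hfu, Function.update_self, Function.update_of_ne hl, hwu, zero_add] at e2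
        exact e2

/-! ### Paths weighted at their ends -/

/-- Deleting the first vertex of an induced path. -/
theorem exists_pathGraph_tail {m : ℕ} (g : SimpleGraph.pathGraph (m + 2) ↪g G) :
    ∃ f : SimpleGraph.pathGraph (m + 1) ↪g G, (∀ i, f i = g i.succ) ∧
      (Finset.univ.image g).erase (g 0) = Finset.univ.image f ∧
      PendantAt G (Finset.univ.image g) (g 0) (f 0) := by
  refine ⟨⟨⟨fun i => g i.succ, g.injective.comp (Fin.succ_injective _)⟩, ?_⟩, fun i => rfl, ?_, ?_⟩
  · intro i j
    refine (g.map_adj_iff (v := i.succ) (w := j.succ)).trans ?_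
    simp [SimpleGraph.pathGraph_adj]
  · ext y
    simp only [Finset.mem_erase, Finset.mem_image, Finset.mem_univ, true_and]
    constructor
    · rintro ⟨hy, i, rfl⟩
      obtain ⟨j, rfl⟩ := Fin.exists_succ_eq.2 (fun h : i = 0 => hy (h ▸ rfl))
      exact ⟨j, rfl⟩
    · rintro ⟨j, rfl⟩
      exact ⟨fun h => Fin.succ_ne_zero j (g.injective h), j.succ, rfl⟩
  · refine ⟨by simp, ?_, ?_, ?_⟩
    · exact Finset.mem_image_of_mem g (Finset.mem_univ (Fin.succ 0))
    · exact g.map_adj_iff.2 (SimpleGraph.pathGraph_adj.2 (Or.inl (by simp)))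
    · intro x hx hadj
      obtain ⟨i, -, rfl⟩ := Finset.mem_image.1 hx
      have h := SimpleGraph.pathGraph_adj.1 (g.map_adj_iff.1 hadj)
      have : i = Fin.succ 0 := by
        ext; simp at h ⊢; omega
      rw [this]; rfl

theorem weightedCount_path_singleton (m : ℕ) (f : SimpleGraph.pathGraph (m + 1) ↪g G) (w : V → ℕ)
    (hw : ∀ i, i ≠ Fin.last m → w (f i) = 0) :
    weightedCount G w (Finset.univ.image f) {f 0} = 2 ^ w (f (Fin.last m)) + m := by
  induction m with
  | zero =>
    have h : (Finset.univ : Finset (Fin (0 + 1))) = {0} := rfl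
    rw [h, Finset.image_singleton, (weightedCount_singleton w (f 0)).2]
    rfl
  | succ m ih =>
    obtain ⟨g, hg, hE, hp⟩ := exists_pathGraph_tail f
    have h0 : w (f 0) = 0 := hw 0 (Fin.last_pos).ne
    have h1 := weightedCount_of_mem w hp (Finset.mem_singleton_self _)
    rw [if_pos rfl, h0, hE, Finset.erase_singleton, insert_empty_eq, ih g] at h1
    · rw [h1, hg, Fin.succ_last]
      ring
    · intro i hi
      rw [hg]
      exact hw _ fun h => hi (Fin.succ_injective _ (h.trans (Fin.succ_last m).symm))

/-- The bound `le_weightedCount` is attained by paths weighted at their ends. -/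
theorem weightedCount_path (m : ℕ) (f : SimpleGraph.pathGraph (m + 1) ↪g G) (w : V → ℕ) {a b : ℕ}
    (hE : EndWeights f w a b) (hw : ∑ x ∈ Finset.univ.image f, w x = a + b) :
    weightedCount G w (Finset.univ.image f) ∅ =
      2 ^ (a + b) + m * (2 ^ a + 2 ^ b) + m.choose 2 := by
  induction m generalizing w with
  | zero =>
    have h : (Finset.univ : Finset (Fin (0 + 1))) = {0} := rfl
    rw [h, Finset.image_singleton] at hw ⊢
    rw [(weightedCount_singleton w (f 0)).1, ← hw]
    simp
  | succ m ih =>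
    obtain ⟨g, hg, hA, hp⟩ := exists_pathGraph_tail f
    obtain ⟨e1, e2⟩ := hE (Nat.succ_pos m)
    have hcon := weightedCount_contract w hp
    have hu := hp.nbr_mem_erase
    have hwv := Finset.add_sum_erase _ w hp.mem
    rw [hA] at hcon hu hwv
    have hw' : ∑ x ∈ Finset.univ.image g,
        Function.update w (g 0) (w (g 0) + w (f 0)) x = a + b := by
      rw [Finset.sum_update_of_mem hu, Finset.sdiff_singleton_eq_erase]
      have := Finset.add_sum_erase _ w hu
      omega
    have hlast : g (Fin.last m) = f (Fin.last (m + 1)) := by rw [hg, Fin.succ_last]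
    have hzero : ∀ i, i ≠ Fin.last m → w (g i) = 0 := by
      intro i hi
      rw [hg]
      exact e1 _ (Fin.succ_ne_zero i)
        fun h => hi (Fin.succ_injective _ (h.trans (Fin.succ_last m).symm))
    have hE' : EndWeights g (Function.update w (g 0) (w (g 0) + w (f 0))) a b := by
      intro hm
      have h0l : (0 : Fin (m + 1)) ≠ Fin.last m := by
        rw [Ne, Fin.ext_iff]; simp; omega
      refine ⟨fun i hi hi' => ?_, ?_⟩
      · rw [Function.update_of_ne (fun h => hi (g.injective h))]
        exact hzero i hi'
      · rw [Function.update_self, Function.update_of_ne (fun h => h0l (g.injective h).symm),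
          hzero 0 h0l, zero_add, hlast]
        exact e2
    have hchoose : (m + 1).choose 2 = m + m.choose 2 := by
      rw [Nat.choose_succ_succ' m 1, Nat.choose_one_right]
    rw [hcon, ih g _ hE' hw', weightedCount_path_singleton m g w hzero, hlast, hchoose,
      Nat.succ_mul m]
    rcases e2 with ⟨h1, h2⟩ | ⟨h1, h2⟩ <;> rw [h1, h2] <;> ring

/-! ### Trees as weighted subtrees -/

theorem PendantAt.mono {A B : Finset V} {v u : V} (h : PendantAt G A v u) (hBA : B ⊆ A)
    (hv : v ∈ B) (hu : u ∈ B) : PendantAt G B v u :=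
  ⟨hv, hu, h.adj, fun x hx => h.unique x (hBA hx)⟩

theorem pendant_erase_union {I K : Finset V} {v : V} (hIK : Disjoint I (insert v K))
    (hv : v ∉ K) : (I ∪ insert v K).erase v = I ∪ K := by
  have hvI : v ∉ I := fun h => Finset.disjoint_left.1 hIK h (Finset.mem_insert_self v K)
  rw [Finset.erase_union_distrib, Finset.erase_insert hv, Finset.erase_eq_of_notMem hvI]

theorem SpansSubtree.of_union_leaves {I K : Finset V} (hIK : Disjoint I K)
    (hK : ∀ v ∈ K, ∃ u ∈ I, PendantAt G (I ∪ K) v u) (h : SpansSubtree G (I ∪ K)) :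
    SpansSubtree G I := by
  induction K using Finset.induction_on with
  | empty => simpa using h
  | insert v K hv ih =>
    have hsub : I ∪ K ⊆ I ∪ insert v K :=
      Finset.union_subset_union (le_refl I) (Finset.subset_insert v K)
    obtain ⟨u, -, hp⟩ := hK v (Finset.mem_insert_self v K)
    refine ih (hIK.mono_right (Finset.subset_insert v K)) (fun x hx => ?_) ?_
    · obtain ⟨z, hz, hq⟩ := hK x (Finset.mem_insert_of_mem hx)
      exact ⟨z, hz, hq.mono hsub (Finset.mem_union_right I hx) (Finset.mem_union_left K hz)⟩
    · rw [← pendant_erase_union hIK hv]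
      exact h.erase hp

/-- A set `K` of leaves contributes its single vertices, and weights on the remaining subtree
`I`. -/
theorem weightedCount_union_leaves {I K : Finset V} (hIK : Disjoint I K)
    (hK : ∀ v ∈ K, ∃ u ∈ I, PendantAt G (I ∪ K) v u) (w : V → ℕ) (hw : ∀ v ∈ K, w v = 0) :
    weightedCount G w (I ∪ K) ∅ =
      K.card + weightedCount G (fun x => w x + (K.filter (G.Adj x)).card) I ∅ := by
  induction K using Finset.induction_on generalizing w with
  | empty => simp
  | insert v K hv ih =>
    have hsub : I ∪ K ⊆ I ∪ insert v K :=
      Finset.union_subset_union (le_refl I) (Finset.subset_insert v K)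
    have hIK' := hIK.mono_right (Finset.subset_insert v K)
    obtain ⟨u, hu, hp⟩ := hK v (Finset.mem_insert_self v K)
    have h1 := weightedCount_erase w hp (Finset.notMem_empty v)
    have h2 := weightedCount_update (G := G) w (I ∪ K) ∅ u 1
    rw [pendant_erase_union hIK hv, hw v (Finset.mem_insert_self v K)] at h1
    simp only [if_true, insert_empty_eq, pow_zero, one_mul, pow_one] at h1 h2
    have h3 := ih hIK' (fun x hx => by
      obtain ⟨z, hz, hq⟩ := hK x (Finset.mem_insert_of_mem hx)
      exact ⟨z, hz, hq.mono hsub (Finset.mem_union_right I hx) (Finset.mem_union_left K hz)⟩)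
      (Function.update w u (w u + 1)) (fun x hx => by
        rw [Function.update_of_ne (by rintro rfl; exact Finset.disjoint_left.1 hIK' hu hx)]
        exact hw x (Finset.mem_insert_of_mem hx))
    have h4 : weightedCount G
        (fun x => Function.update w u (w u + 1) x + (K.filter (G.Adj x)).card) I ∅ =
        weightedCount G (fun x => w x + ((insert v K).filter (G.Adj x)).card) I ∅ := by
      refine weightedCount_congr (fun x hx => ?_) ∅
      rw [Finset.filter_insert]
      by_cases hxu : x = u
      · subst hxu
        rw [if_pos hp.adj.symm, Function.update_self, Finset.card_insert_of_notMem (by simp [hv])]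
        ring
      · rw [if_neg fun h => hxu (hp.unique x (Finset.mem_union_left _ hx) h.symm),
          Function.update_of_ne hxu]
    rw [Finset.card_insert_of_notMem hv]
    omega

theorem sum_card_leaves {I K : Finset V} (hK : ∀ v ∈ K, ∃ u ∈ I, PendantAt G (I ∪ K) v u) :
    ∑ x ∈ I, (K.filter (G.Adj x)).card = K.card := by
  simp only [Finset.card_filter]
  rw [Finset.sum_comm, Finset.card_eq_sum_ones]
  refine Finset.sum_congr rfl fun v hv => ?_
  obtain ⟨u, hu, hp⟩ := hK v hv
  rw [Finset.sum_eq_single u, if_pos hp.adj.symm]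
  · intro x hx hxu
    exact if_neg fun h => hxu (hp.unique x (Finset.mem_union_left K hx) h.symm)
  · exact fun h => absurd hu h

/-- The lower bound for a tree with a prescribed set `K` of leaves, and the structure of the trees
attaining it. -/
theorem le_count_of_leaves (hG : G.IsAcyclic) {a b : ℕ} (hab : a ≤ b) (hba : b ≤ a + 1) {m : ℕ}
    {I K : Finset V} (hIK : Disjoint I K) (hK : ∀ v ∈ K, ∃ u ∈ I, PendantAt G (I ∪ K) v u)
    (h : SpansSubtree G (I ∪ K)) (hI : I.card = m + 1) (hKc : K.card = a + b) :
    m * (2 ^ a + 2 ^ b) + m.choose 2 + 2 ^ (a + b) + (a + b) ≤ countContaining G (I ∪ K) ∅ ∧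
    (countContaining G (I ∪ K) ∅ = m * (2 ^ a + 2 ^ b) + m.choose 2 + 2 ^ (a + b) + (a + b) →
      ∃ f : SimpleGraph.pathGraph (m + 1) ↪g G, Finset.univ.image f = I ∧
        EndWeights f (fun x => (K.filter (G.Adj x)).card) a b) := by
  have h1 := weightedCount_union_leaves hIK hK 0 (fun _ _ => rfl)
  simp only [Pi.zero_apply, zero_add] at h1
  obtain ⟨h2, h3⟩ := le_weightedCount hG hab hba m (h.of_union_leaves hIK hK) hI
    (fun x => (K.filter (G.Adj x)).card) ((sum_card_leaves hK).trans hKc)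
  unfold countContaining
  exact ⟨by omega, fun heq => h3 (by omega)⟩

theorem count_path_union_leaves {a b m : ℕ} {K : Finset V}
    (f : SimpleGraph.pathGraph (m + 1) ↪g G) (hIK : Disjoint (Finset.univ.image f) K)
    (hK : ∀ v ∈ K, ∃ u ∈ Finset.univ.image f, PendantAt G (Finset.univ.image f ∪ K) v u)
    (hKc : K.card = a + b) (hE : EndWeights f (fun x => (K.filter (G.Adj x)).card) a b) :
    countContaining G (Finset.univ.image f ∪ K) ∅ =
      m * (2 ^ a + 2 ^ b) + m.choose 2 + 2 ^ (a + b) + (a + b) := by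
  have h1 := weightedCount_union_leaves hIK hK 0 (fun _ _ => rfl)
  simp only [Pi.zero_apply, zero_add] at h1
  have h2 := weightedCount_path m f _ hE ((sum_card_leaves hK).trans hKc)
  unfold countContaining
  omega

/-- The number of subtrees of a path `f` with `a` and `b` leaves attached to its ends. -/
theorem count_path_with_leaves [Fintype V] {a b m : ℕ} (f : SimpleGraph.pathGraph (m + 1) ↪g G)
    (e : Fin a ⊕ Fin b ↪ V) (hcov : ∀ x, (∃ i, f i = x) ∨ ∃ j, e j = x)
    (hfe : ∀ i j, f i ≠ e j)
    (h0 : ∀ i x, G.Adj (e (Sum.inl i)) x ↔ x = f 0)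
    (h1 : ∀ i x, G.Adj (e (Sum.inr i)) x ↔ x = f (Fin.last m)) :
    countContaining G Finset.univ ∅ =
      m * (2 ^ a + 2 ^ b) + m.choose 2 + 2 ^ (a + b) + (a + b) := by
  have hU : Finset.univ = Finset.univ.image f ∪ Finset.univ.image e := by
    refine (Finset.eq_univ_iff_forall.2 fun x => ?_).symm
    rw [Finset.mem_union, Finset.mem_image, Finset.mem_image]
    simpa using hcov x
  rw [hU]
  refine count_path_union_leaves (K := Finset.univ.image e) f ?_ ?_ ?_ ?_
  · rw [Finset.disjoint_left]
    intro x hx hx'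
    obtain ⟨i, -, rfl⟩ := Finset.mem_image.1 hx
    obtain ⟨j, -, hj⟩ := Finset.mem_image.1 hx'
    exact hfe i j hj.symm
  · intro v hv
    have hf : ∀ i, f i ∈ Finset.univ.image f := fun i =>
      Finset.mem_image_of_mem f (Finset.mem_univ i)
    obtain ⟨i | i, -, rfl⟩ := Finset.mem_image.1 hv
    · exact ⟨f 0, hf 0, Finset.mem_union_right _ hv, Finset.mem_union_left _ (hf 0),
        (h0 i _).2 rfl, fun x _ hx => (h0 i x).1 hx⟩
    · exact ⟨f _, hf _, Finset.mem_union_right _ hv, Finset.mem_union_left _ (hf _),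
        (h1 i _).2 rfl, fun x _ hx => (h1 i x).1 hx⟩
  · rw [Finset.card_image_of_injective _ e.injective, Finset.card_univ, Fintype.card_sum,
      Fintype.card_fin, Fintype.card_fin]
  · intro hm
    have h0l : (0 : Fin (m + 1)) ≠ Fin.last m := by
      rw [Ne, Fin.ext_iff]; simp; omega
    refine ⟨fun i hi hi' => ?_, Or.inl ⟨?_, ?_⟩⟩
    · rw [Finset.card_eq_zero, Finset.filter_eq_empty_iff]
      intro v hv hadj
      obtain ⟨j | j, -, rfl⟩ := Finset.mem_image.1 hv
      · exact hi (f.injective ((h0 j _).1 hadj.symm))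
      · exact hi' (f.injective ((h1 j _).1 hadj.symm))
    · have : (Finset.univ.image e).filter (G.Adj (f 0)) =
          Finset.univ.image fun i : Fin a => e (Sum.inl i) := by
        ext v
        rw [Finset.mem_filter, Finset.mem_image, Finset.mem_image]
        constructor
        · rintro ⟨⟨i | i, -, rfl⟩, hadj⟩
          · exact ⟨i, Finset.mem_univ i, rfl⟩
          · exact absurd (f.injective ((h1 i _).1 hadj.symm)) h0l
        · rintro ⟨i, -, rfl⟩
          exact ⟨⟨_, Finset.mem_univ _, rfl⟩, ((h0 i _).2 rfl).symm⟩
      refine (congrArg Finset.card this).trans ?_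
      refine (Finset.card_image_of_injective _ fun _ _ h => Sum.inl_injective
        (e.injective h)).trans ?_
      rw [Finset.card_univ, Fintype.card_fin]
    · have : (Finset.univ.image e).filter (G.Adj (f (Fin.last m))) =
          Finset.univ.image fun i : Fin b => e (Sum.inr i) := by
        ext v
        rw [Finset.mem_filter, Finset.mem_image, Finset.mem_image]
        constructor
        · rintro ⟨⟨i | i, -, rfl⟩, hadj⟩
          · exact absurd (f.injective ((h0 i _).1 hadj.symm)).symm h0l
          · exact ⟨i, Finset.mem_univ i, rfl⟩
        · rintro ⟨i, -, rfl⟩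
          exact ⟨⟨_, Finset.mem_univ _, rfl⟩, ((h1 i _).2 rfl).symm⟩
      refine (congrArg Finset.card this).trans ?_
      refine (Finset.card_image_of_injective _ fun _ _ h => Sum.inr_injective
        (e.injective h)).trans ?_
      rw [Finset.card_univ, Fintype.card_fin]

/-! ### Finite trees and their bipartitions -/

theorem subtreeCount_eq [Fintype V] (T : SimpleGraph V) :
    subtreeCount T = countContaining T Finset.univ ∅ := by
  rw [countContaining_eq_card, ← Set.ncard_coe_finset, subtreeCount,
    ← Set.ncard_image_of_injective _ Finset.coe_injective]
  congr 1
  ext S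
  simp only [Set.mem_ofPred_eq, Finset.coe_filter, Finset.mem_powerset, Finset.subset_univ,
    Finset.empty_subset, and_true, true_and, Set.mem_image, SpansSubtree]
  constructor
  · intro h
    exact ⟨S.toFinset, by rwa [Set.coe_toFinset], Set.coe_toFinset S⟩
  · rintro ⟨A, hA, rfl⟩
    exact hA

theorem subtreeCount_congr {W : Type*} {T : SimpleGraph V} {T' : SimpleGraph W} (e : T ≃g T') :
    subtreeCount T = subtreeCount T' := by
  unfold subtreeCount
  rw [← Set.ncard_image_of_injective _ (Set.image_injective.2 e.injective)]
  congr 1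
  ext S
  simp only [Set.mem_image, Set.mem_ofPred_eq]
  constructor
  · rintro ⟨R, hR, rfl⟩
    exact (SimpleGraph.Iso.connected_iff (e.induce (e.injective.injOn.bijOn_image (s := R)))).1 hR
  · intro h
    have hS := Set.image_preimage_eq S e.surjective
    refine ⟨e ⁻¹' S, ?_, hS⟩
    refine (SimpleGraph.Iso.connected_iff
      (e.induce (e.injective.injOn.bijOn_image (s := e ⁻¹' S)))).2 ?_
    rwa [hS]

/-- `T` is a tree with colour classes `V₁` and `V₂`. -/
structure TreeWithClasses (T : SimpleGraph V) (V₁ V₂ : Set V) : Prop where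
  isTree : T.IsTree
  union_eq : V₁ ∪ V₂ = Set.univ
  bipartite : T.IsBipartiteWith V₁ V₂

theorem TreeWithClasses.symm {T : SimpleGraph V} {V₁ V₂ : Set V} (h : TreeWithClasses T V₁ V₂) :
    TreeWithClasses T V₂ V₁ :=
  ⟨h.isTree, by rw [Set.union_comm, h.union_eq], h.bipartite.symm⟩

theorem TreeWithClasses.isBipartitionTree [Finite V] {T : SimpleGraph V} {V₁ V₂ : Set V}
    (h : TreeWithClasses T V₁ V₂) {n p q : ℕ} (h1 : V₁.ncard = p) (h2 : V₂.ncard = q)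
    (hn : p + q = n) : IsBipartitionTree n p q T := by
  refine ⟨h.isTree, ?_, V₁, V₂, h.union_eq, h.bipartite, h1, h2⟩
  rw [← Set.ncard_univ, ← h.union_eq, Set.ncard_union_eq h.bipartite.disjoint, h1, h2, hn]

theorem TreeWithClasses.exists_biSubtree [Fintype V] {T : SimpleGraph V} {V₁ V₂ : Set V}
    (h : TreeWithClasses T V₁ V₂) : ∃ P Q, BiSubtree T P Q ∧ P ∪ Q = Finset.univ ∧
      P.card = V₁.ncard ∧ Q.card = V₂.ncard ∧ (∀ x, x ∈ P ↔ x ∈ V₁) ∧ ∀ x, x ∈ Q ↔ x ∈ V₂ := by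
  have hdis := h.bipartite.disjoint
  have hU : V₁.toFinset ∪ V₂.toFinset = Finset.univ := by
    rw [← Set.toFinset_union, ← Set.toFinset_univ]
    exact Set.toFinset_congr h.union_eq
  refine ⟨V₁.toFinset, V₂.toFinset, ⟨Set.disjoint_toFinset.2 hdis, ?_, ?_, ?_⟩, hU,
    (Set.ncard_eq_toFinset_card' V₁).symm, (Set.ncard_eq_toFinset_card' V₂).symm,
    fun x => Set.mem_toFinset, fun x => Set.mem_toFinset⟩
  · intro x hx y hy hadj
    rw [Set.mem_toFinset] at hx hy
    rcases h.bipartite.mem_of_adj hadj with ⟨_, h2⟩ | ⟨h2, _⟩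
    · exact Set.disjoint_left.1 hdis hy h2
    · exact Set.disjoint_left.1 hdis hx h2
  · intro x hx y hy hadj
    rw [Set.mem_toFinset] at hx hy
    rcases h.bipartite.mem_of_adj hadj with ⟨h2, _⟩ | ⟨_, h2⟩
    · exact Set.disjoint_left.1 hdis h2 hx
    · exact Set.disjoint_left.1 hdis h2 hy
  · rw [hU, SpansSubtree, Finset.coe_univ]
    exact (SimpleGraph.Iso.connected_iff (SimpleGraph.induceUnivIso T)).2 h.isTree.connected

theorem IsBipartitionTree.exists_biSubtree [Fintype V] {n p q : ℕ} {T : SimpleGraph V}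
    (h : IsBipartitionTree n p q T) : ∃ P Q, BiSubtree T P Q ∧ P ∪ Q = Finset.univ ∧
      P.card = p ∧ Q.card = q := by
  obtain ⟨V₁, V₂, h1, h2, h3, h4⟩ := h.bipartition
  obtain ⟨P, Q, h5, h6, h7, h8, -⟩ := (TreeWithClasses.mk h.isTree h1 h2).exists_biSubtree
  exact ⟨P, Q, h5, h6, h7.trans h3, h8.trans h4⟩

/-! ### The extremal trees are trees -/

theorem isTree_of_card_edgeSet_le [Finite V] {T : SimpleGraph V} (h : T.Connected)
    (hc : Nat.card T.edgeSet + 1 ≤ Nat.card V) : T.IsTree :=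
  SimpleGraph.isTree_iff_connected_and_card.2
    ⟨h, le_antisymm hc h.card_vert_le_card_edgeSet_add_one⟩

theorem isTree_pathGraph (m : ℕ) : (SimpleGraph.pathGraph (m + 1)).IsTree := by
  refine isTree_of_card_edgeSet_le (SimpleGraph.pathGraph_connected m) ?_
  have hadj : ∀ i : Fin m, (SimpleGraph.pathGraph (m + 1)).Adj i.castSucc i.succ := fun i =>
    SimpleGraph.pathGraph_adj.2 (Or.inl (by simp))
  have hsurj : Function.Surjective
      (fun i : Fin m => (⟨s(i.castSucc, i.succ), hadj i⟩ :
        (SimpleGraph.pathGraph (m + 1)).edgeSet)) := by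
    rintro ⟨e, he⟩
    induction e using Sym2.ind with
    | _ x y =>
      rw [SimpleGraph.mem_edgeSet] at he
      rcases SimpleGraph.pathGraph_adj.1 he with h | h
      · refine ⟨⟨x.val, by omega⟩, Subtype.ext (Sym2.eq_iff.2 (Or.inl ⟨?_, ?_⟩))⟩
        · rfl
        · ext; simpa using h
      · refine ⟨⟨y.val, by omega⟩, Subtype.ext (Sym2.eq_iff.2 (Or.inr ⟨?_, ?_⟩))⟩
        · rfl
        · ext; simpa using h
  have h1 : Nat.card (SimpleGraph.pathGraph (m + 1)).edgeSet ≤ Nat.card (Fin m) :=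
    Nat.card_le_card_of_surjective _ hsurj
  rw [Nat.card_eq_fintype_card (α := Fin m), Fintype.card_fin] at h1
  rw [Nat.card_eq_fintype_card (α := Fin (m + 1)), Fintype.card_fin]
  omega

@[simp] theorem attachPendants_inl_inl (H : SimpleGraph V) (v a b : V) (m : ℕ) :
    (attachPendants H v m).Adj (Sum.inl a) (Sum.inl b) ↔ H.Adj a b := Iff.rfl

@[simp] theorem attachPendants_inl_inr (H : SimpleGraph V) (v a : V) (m : ℕ) (i : Fin m) :
    (attachPendants H v m).Adj (Sum.inl a) (Sum.inr i) ↔ a = v := Iff.rfl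

@[simp] theorem attachPendants_inr_inl (H : SimpleGraph V) (v a : V) (m : ℕ) (i : Fin m) :
    (attachPendants H v m).Adj (Sum.inr i) (Sum.inl a) ↔ a = v := Iff.rfl

@[simp] theorem attachPendants_inr_inr (H : SimpleGraph V) (v : V) (m : ℕ) (i j : Fin m) :
    ¬ (attachPendants H v m).Adj (Sum.inr i) (Sum.inr j) := id

theorem isTree_attachPendants [Finite V] {H : SimpleGraph V} (hH : H.IsTree) (v : V) (m : ℕ) :
    (attachPendants H v m).IsTree := by
  have hinl : ∀ a b, H.Adj a b → (attachPendants H v m).Adj (Sum.inl a) (Sum.inl b) :=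
    fun a b h => h
  have hinr : ∀ i, (attachPendants H v m).Adj (Sum.inl v) (Sum.inr i) := fun i => rfl
  refine isTree_of_card_edgeSet_le ?_ ?_
  · rw [SimpleGraph.connected_iff_exists_forall_reachable]
    refine ⟨Sum.inl v, ?_⟩
    rintro (a | i)
    · let φ : H →g attachPendants H v m := ⟨Sum.inl, fun {a b} h => hinl a b h⟩
      exact (hH.connected v a).map φ
    · exact (hinr i).reachable
  · let φ : H →g attachPendants H v m := ⟨Sum.inl, fun {a b} h => hinl a b h⟩
    have hsurj : Function.Surjective (Sum.elim φ.mapEdgeSet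
        (fun i : Fin m => (⟨s(Sum.inl v, Sum.inr i), hinr i⟩ :
          (attachPendants H v m).edgeSet))) := by
      rintro ⟨e, he⟩
      induction e using Sym2.ind with
      | _ x y =>
        rw [SimpleGraph.mem_edgeSet] at he
        rcases x with a | i <;> rcases y with b | j
        · exact ⟨Sum.inl ⟨s(a, b), he⟩, rfl⟩
        · obtain rfl : a = v := he
          exact ⟨Sum.inr j, rfl⟩
        · obtain rfl : b = v := he
          exact ⟨Sum.inr i, Subtype.ext Sym2.eq_swap⟩
        · exact absurd he id
    have h1 := Nat.card_le_card_of_surjective _ hsurj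
    have h2 := (SimpleGraph.isTree_iff_connected_and_card.1 hH).2
    rw [Nat.card_sum, Nat.card_eq_fintype_card (α := Fin m), Fintype.card_fin] at h1 ⊢
    omega

/-- The new vertices lie in the class opposite to the vertex `v` that they are attached to. -/
theorem TreeWithClasses.attachPendants [Finite V] {H : SimpleGraph V} {V₁ V₂ : Set V}
    (h : TreeWithClasses H V₁ V₂) {v : V} (hv : v ∈ V₁) (m : ℕ) :
    TreeWithClasses (attachPendants H v m) (Sum.inl '' V₁) (Sum.inl '' V₂ ∪ Set.range Sum.inr) := by
  refine ⟨isTree_attachPendants h.isTree v m, ?_, ?_, ?_⟩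
  · ext (a | i)
    · have : a ∈ V₁ ∪ V₂ := h.union_eq ▸ Set.mem_univ a
      simpa using this
    · simp
  · rw [Set.disjoint_left]
    rintro _ ⟨a, ha, rfl⟩ (⟨b, hb, hab⟩ | ⟨i, hi⟩)
    · exact Set.disjoint_left.1 h.bipartite.disjoint ha (Sum.inl_injective hab ▸ hb)
    · simp at hi
  · rintro (a | i) (b | j) hadj
    · simpa using h.bipartite.mem_of_adj hadj
    · obtain rfl : a = v := hadj
      left; simpa using hv
    · obtain rfl : b = v := hadj
      right; simpa using hv
    · exact absurd hadj id

theorem ncard_inl_union_inr {m : ℕ} [Finite V] (S : Set V) :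
    ((Sum.inl '' S ∪ Set.range Sum.inr : Set (V ⊕ Fin m))).ncard = S.ncard + m := by
  rw [Set.ncard_union_eq, Set.ncard_image_of_injective _ Sum.inl_injective, ← Set.image_univ,
    Set.ncard_image_of_injective _ Sum.inr_injective, Set.ncard_univ, Nat.card_eq_fintype_card,
    Fintype.card_fin]
  rw [Set.disjoint_left]
  rintro _ ⟨a, ha, rfl⟩ ⟨i, hi⟩
  simp at hi

theorem treeWithClasses_starGraph (p : ℕ) :
    TreeWithClasses (SimpleGraph.starGraph (0 : Fin (p + 1))) {0}ᶜ {0} := by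
  refine ⟨SimpleGraph.isTree_starGraph 0, Set.compl_union_self _, disjoint_compl_left, ?_⟩
  intro a b hab
  rw [SimpleGraph.starGraph_adj] at hab
  obtain ⟨hne, rfl | rfl⟩ := hab
  · right; simp [hne.symm]
  · left; simp [hne]

theorem treeWithClasses_doubleStar {p : ℕ} (hp : 1 ≤ p) (q : ℕ) :
    TreeWithClasses (doubleStar p q) (Sum.inl '' {0}ᶜ) (Sum.inl '' {0} ∪ Set.range Sum.inr) := by
  refine (treeWithClasses_starGraph p).attachPendants ?_ (q - 1)
  rw [Set.mem_compl_singleton_iff, Ne, Fin.ext_iff]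
  simp
  omega

theorem ncard_compl_zero (p : ℕ) : ({0}ᶜ : Set (Fin (p + 1))).ncard = p := by
  rw [Set.ncard_compl, Set.ncard_singleton, Nat.card_eq_fintype_card, Fintype.card_fin]
  omega

theorem isBipartitionTree_doubleStar {n p q : ℕ} (hp : 1 ≤ p) (hq : 1 ≤ q) (hn : p + q = n) :
    IsBipartitionTree n p q (doubleStar p q) := by
  refine (treeWithClasses_doubleStar hp q).isBipartitionTree ?_ ?_ hn
  · rw [Set.ncard_image_of_injective _ Sum.inl_injective, ncard_compl_zero]
  · rw [ncard_inl_union_inr, Set.ncard_singleton]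
    omega

theorem treeB_of_three_le {p q : ℕ} (hp : 3 ≤ p) (hpq : p ≤ q) :
    treeB p q = ⟨(Fin (p - 1 + 1) ⊕ Fin (q - 1)) ⊕ Fin 1,
      attachPendants (doubleStar (p - 1) q) (Sum.inr ⟨0, by omega⟩) 1⟩ :=
  dif_pos ⟨hp, hpq⟩

theorem treeB_two (q : ℕ) :
    treeB 2 q = ⟨Fin 4 ⊕ Fin (q - 2), attachPendants (SimpleGraph.pathGraph 4) 0 (q - 2)⟩ :=
  dif_neg (by omega)

theorem treeWithClasses_attach_doubleStar {p q : ℕ} (hp : 3 ≤ p) (hq : 0 < q - 1) :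
    TreeWithClasses (attachPendants (doubleStar (p - 1) q) (Sum.inr ⟨0, hq⟩) 1)
      (Sum.inl '' (Sum.inl '' {0}ᶜ) ∪ Set.range Sum.inr)
      (Sum.inl '' (Sum.inl '' {0} ∪ Set.range Sum.inr)) :=
  ((treeWithClasses_doubleStar (p := p - 1) (by omega) q).symm.attachPendants
    (Or.inr ⟨_, rfl⟩) 1).symm

theorem treeWithClasses_pathGraph (p : ℕ) (hp : 1 ≤ p) :
    TreeWithClasses (SimpleGraph.pathGraph (2 * p - 1 - 1 + 1))
      (Set.range fun i : Fin p => (⟨2 * i.val, by omega⟩ : Fin (2 * p - 1 - 1 + 1)))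
      (Set.range fun i : Fin (p - 1) => (⟨2 * i.val + 1, by omega⟩ : Fin (2 * p - 1 - 1 + 1))) := by
  have hmem : ∀ x : Fin (2 * p - 1 - 1 + 1),
      (x ∈ (Set.range fun i : Fin p => (⟨2 * i.val, by omega⟩ : Fin (2 * p - 1 - 1 + 1))) ↔
        x.val % 2 = 0) ∧
      (x ∈ (Set.range fun i : Fin (p - 1) =>
        (⟨2 * i.val + 1, by omega⟩ : Fin (2 * p - 1 - 1 + 1))) ↔ x.val % 2 = 1) := by
    intro x
    constructor
    · constructor
      · rintro ⟨i, rfl⟩; simp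
      · intro h
        exact ⟨⟨x.val / 2, by omega⟩, Fin.ext (by simp only []; omega)⟩
    · constructor
      · rintro ⟨i, rfl⟩; simp only []; omega
      · intro h
        exact ⟨⟨x.val / 2, by omega⟩, Fin.ext (by simp only []; omega)⟩
  refine ⟨isTree_pathGraph _, ?_, ?_, ?_⟩
  · ext x
    rw [Set.mem_union, (hmem x).1, (hmem x).2]
    simp only [Set.mem_univ, iff_true]
    omega
  · rw [Set.disjoint_left]
    intro x h1 h2
    rw [(hmem x).1] at h1
    rw [(hmem x).2] at h2
    omega
  · intro x y h
    rw [(hmem x).1, (hmem x).2, (hmem y).1, (hmem y).2]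
    rw [SimpleGraph.pathGraph_adj] at h
    omega

theorem treeWithClasses_pathWithPendants (p a b : ℕ) (hp : 1 ≤ p) :
    TreeWithClasses (pathWithPendants (2 * p - 1) a b)
      (Sum.inl '' (Sum.inl ''
        (Set.range fun i : Fin p => (⟨2 * i.val, by omega⟩ : Fin (2 * p - 1 - 1 + 1)))))
      (Sum.inl '' (Sum.inl '' (Set.range fun i : Fin (p - 1) =>
        (⟨2 * i.val + 1, by omega⟩ : Fin (2 * p - 1 - 1 + 1))) ∪ Set.range Sum.inr) ∪
        Set.range Sum.inr) := by
  refine ((treeWithClasses_pathGraph p hp).attachPendants ?_ a).attachPendants ?_ b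
  · exact ⟨⟨0, hp⟩, rfl⟩
  · exact ⟨_, ⟨⟨p - 1, by omega⟩, Fin.ext (by simp only [Fin.val_last]; omega)⟩, rfl⟩

theorem isBipartitionTree_pathWithPendants {n p q a b : ℕ} (hp : 1 ≤ p) (hn : p + q = n)
    (hab : a + b + p = q + 1) : IsBipartitionTree n p q (pathWithPendants (2 * p - 1) a b) := by
  refine (treeWithClasses_pathWithPendants p a b hp).isBipartitionTree ?_ ?_ hn
  · rw [Set.ncard_image_of_injective _ Sum.inl_injective,
      Set.ncard_image_of_injective _ Sum.inl_injective, ← Set.image_univ,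
      Set.ncard_image_of_injective, Set.ncard_univ, Nat.card_eq_fintype_card, Fintype.card_fin]
    intro i j h
    simp only [Fin.mk.injEq] at h
    exact Fin.ext (by omega)
  · rw [ncard_inl_union_inr, ncard_inl_union_inr, ← Set.image_univ,
      Set.ncard_image_of_injective, Set.ncard_univ, Nat.card_eq_fintype_card, Fintype.card_fin]
    · omega
    · intro i j h
      simp only [Fin.mk.injEq] at h
      exact Fin.ext (by omega)

/-! ### Recognizing the extremal trees -/

/-- Extends an embedding of `H` into `G` to `attachPendants H v m`, the new vertices being sent
to the vertices `e i`. -/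
theorem exists_embedding_attachPendants {W : Type*} {H : SimpleGraph W} (f : H ↪g G) (v : W)
    {m : ℕ} (e : Fin m → V) (he : Function.Injective e) (hne : ∀ x i, f x ≠ e i)
    (hadj : ∀ i x, G.Adj (e i) (f x) ↔ x = v) (hind : ∀ i j, ¬ G.Adj (e i) (e j)) :
    ∃ g : attachPendants H v m ↪g G, (∀ x, g (Sum.inl x) = f x) ∧ ∀ i, g (Sum.inr i) = e i := by
  refine ⟨⟨⟨Sum.elim f e, f.injective.sumElim he hne⟩, ?_⟩, fun x => rfl, fun i => rfl⟩
  rintro (x | i) (y | j)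
  · exact f.map_adj_iff
  · exact (G.adj_comm _ _).trans (hadj j x)
  · exact hadj i y
  · exact iff_of_false (hind i j) id

/-- An embedding between finite graphs of the same size is an isomorphism. -/
theorem nonempty_iso_of_card_eq [Finite V] {W : Type*} [Finite W] {H : SimpleGraph W}
    (f : H ↪g G) (h : Nat.card W = Nat.card V) : Nonempty (G ≃g H) := by
  have := Fintype.ofFinite V
  have := Fintype.ofFinite W
  rw [Nat.card_eq_fintype_card, Nat.card_eq_fintype_card] at h
  have hb : Function.Bijective f :=
    (Fintype.bijective_iff_injective_and_card f).2 ⟨f.injective, h⟩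
  exact ⟨(⟨Equiv.ofBijective f hb, fun {a b} => f.map_adj_iff⟩ : H ≃g G).symm⟩

theorem exists_enumeration {S : Finset V} {k : ℕ} (hS : S.card = k) :
    ∃ e : Fin k → V, Function.Injective e ∧ ∀ i, e i ∈ S :=
  ⟨fun i => ((S.equivFinOfCardEq hS).symm i).1,
    Subtype.val_injective.comp (S.equivFinOfCardEq hS).symm.injective,
    fun i => ((S.equivFinOfCardEq hS).symm i).2⟩

theorem exists_enumeration_apply_eq {S : Finset V} {k : ℕ} (hS : S.card = k) {s : V} (hs : s ∈ S)
    (i₀ : Fin k) : ∃ e : Fin k → V, Function.Injective e ∧ (∀ i, e i ∈ S) ∧ e i₀ = s := by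
  let e₀ := S.equivFinOfCardEq hS
  let e : Fin k ≃ S := (Equiv.swap i₀ (e₀ ⟨s, hs⟩)).trans e₀.symm
  exact ⟨fun i => (e i).1, Subtype.val_injective.comp e.injective, fun i => (e i).2, by simp [e]⟩

/-- The concrete double star maps onto a double star, with a prescribed image of one of the leaves
at the centre `d` (if there are any). -/
theorem DoubleStarAt.exists_embedding {P Q : Finset V} (hT : BiSubtree G P Q) (hG : G.IsAcyclic)
    {c d : V} (h : DoubleStarAt G P Q c d) {p q : ℕ} (hp : P.card = p) (hq : Q.card = q) :
    Nonempty (doubleStar p q ↪g G) ∧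
    ∀ x ∈ Q, x ≠ c → ∀ i₀ : Fin (q - 1), ∃ f : doubleStar p q ↪g G,
      (∀ z, f z ∈ P ∪ Q) ∧ f (Sum.inr i₀) = x := by
  obtain ⟨m, rfl⟩ : ∃ m, p = m + 1 :=
    Nat.exists_eq_add_one.2 (hp ▸ Finset.card_pos.2 ⟨d, h.d_mem⟩)
  obtain ⟨e₁, he₁, heP, hed⟩ := exists_enumeration_apply_eq hp h.d_mem (Fin.last m)
  have hcP : ∀ i, e₁ i ≠ c := fun i hi => hT.notMem_left h.c_mem (hi ▸ heP i)
  have hstar : ∃ g : SimpleGraph.starGraph (0 : Fin (m + 1 + 1)) ↪g G,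
      g 0 = c ∧ ∀ i : Fin (m + 1), g i.succ = e₁ i := by
    refine ⟨⟨⟨Fin.cons c e₁, ?_⟩, ?_⟩, rfl, fun i => rfl⟩
    · rw [Fin.cons_injective_iff]
      exact ⟨by rintro ⟨i, hi⟩; exact hcP i hi, he₁⟩
    · intro i j
      rw [SimpleGraph.starGraph_adj]
      refine Fin.cases ?_ (fun i => ?_) i <;> refine Fin.cases ?_ (fun j => ?_) j
      · simp
      · exact iff_of_true (h.dom_c _ (heP j)) ⟨(Fin.succ_ne_zero j).symm, Or.inl rfl⟩
      · exact iff_of_true (h.dom_c _ (heP i)).symm ⟨Fin.succ_ne_zero i, Or.inr rfl⟩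
      · exact iff_of_false (hT.indep_left _ (heP i) _ (heP j))
          fun h => h.2.elim (Fin.succ_ne_zero i) (Fin.succ_ne_zero j)
  obtain ⟨g, hg0, hg⟩ := hstar
  have key : ∀ e : Fin (q - 1) → V, Function.Injective e → (∀ i, e i ∈ Q.erase c) →
      ∃ f : doubleStar (m + 1) q ↪g G, (∀ z, f z ∈ P ∪ Q) ∧ ∀ i, f (Sum.inr i) = e i := by
    intro e he heQ
    have heQ' : ∀ i, e i ∈ Q := fun i => Finset.mem_of_mem_erase (heQ i)
    have hne : ∀ x i, g x ≠ e i := by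
      intro x i
      refine Fin.cases ?_ (fun j => ?_) x
      · rw [hg0]; exact (Finset.ne_of_mem_erase (heQ i)).symm
      · rw [hg]; exact fun hj => hT.notMem_left (heQ' i) (hj ▸ heP j)
    have hadj : ∀ i x, G.Adj (e i) (g x) ↔ x = Fin.last (m + 1) := by
      intro i x
      refine Fin.cases ?_ (fun j => ?_) x
      · rw [hg0]
        refine iff_of_false (hT.indep_right _ (heQ' i) _ h.c_mem) fun h => ?_
        rw [Fin.ext_iff] at h; simp at h
      · rw [hg, ← Fin.succ_last, Fin.succ_inj]
        constructor
        · intro hadj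
          refine he₁ (hed ▸ ?_)
          exact hG.eq_of_common_adj (Finset.ne_of_mem_erase (heQ i)) hadj
            (h.dom_c _ (heP j)).symm (h.dom_d _ (heQ' i)).symm (h.dom_c _ h.d_mem).symm
        · rintro rfl
          rw [hed]
          exact (h.dom_d _ (heQ' i)).symm
    obtain ⟨f, hf1, hf2⟩ := exists_embedding_attachPendants g (Fin.last (m + 1)) e he hne hadj
      fun i j => hT.indep_right _ (heQ' i) _ (heQ' j)
    refine ⟨f, ?_, hf2⟩
    rintro (x | i)
    · refine (hf1 x) ▸ Fin.cases ?_ (fun i => ?_) x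
      · rw [hg0]; exact Finset.mem_union_right _ h.c_mem
      · rw [hg]; exact Finset.mem_union_left _ (heP i)
    · exact (hf2 i) ▸ Finset.mem_union_right _ (heQ' i)
  have hcard : (Q.erase c).card = q - 1 := by rw [Finset.card_erase_of_mem h.c_mem, hq]
  constructor
  · obtain ⟨e, he, heQ⟩ := exists_enumeration hcard
    obtain ⟨f, -⟩ := key e he heQ
    exact ⟨f⟩
  · intro x hx hxc i₀
    obtain ⟨e, he, heQ, hei⟩ := exists_enumeration_apply_eq hcard
      (Finset.mem_erase.2 ⟨hxc, hx⟩) i₀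
    obtain ⟨f, hf1, hf2⟩ := key e he heQ
    exact ⟨f, hf1, (hf2 i₀).trans hei⟩

theorem DoubleStarAt.nonempty_iso [Finite V] (hG : G.IsAcyclic) {P Q : Finset V}
    (hT : BiSubtree G P Q) {c d : V} (h : DoubleStarAt G P Q c d) {p q : ℕ} (hp : P.card = p)
    (hq : Q.card = q) (hn : Nat.card V = p + q) : Nonempty (G ≃g doubleStar p q) := by
  obtain ⟨⟨f⟩, -⟩ := h.exists_embedding hT hG hp hq
  refine nonempty_iso_of_card_eq f ?_
  have : 0 < q := hq ▸ Finset.card_pos.2 ⟨c, h.c_mem⟩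
  rw [hn, Nat.card_sum, Nat.card_eq_fintype_card, Nat.card_eq_fintype_card, Fintype.card_fin,
    Fintype.card_fin]
  omega

theorem IsNearDoubleStar.nonempty_iso_of_three_le [Finite V] (hG : G.IsAcyclic) {P Q : Finset V}
    (hT : BiSubtree G P Q) (h : IsNearDoubleStar G P Q) {p q : ℕ} (hp : P.card = p)
    (hq : Q.card = q) (hn : Nat.card V = p + q) (hp3 : 3 ≤ p) (hpq : p ≤ q) :
    Nonempty (G ≃g (treeB p q).2) := by
  obtain ⟨d, hd, c, hc, y, hy, hdom, hcy, hdom'⟩ := h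
  have hyd : y ≠ d := by rintro rfl; exact hcy (hdom c hc).symm
  obtain ⟨x, hx, hyx⟩ := hT.symm.exists_adj ⟨c, hc⟩ hy
  have hp' := BiSubtree.pendant_symm (hT.symm.pendant_of_dominates hG hdom hy hyd hx hyx)
  have hD : DoubleStarAt G (P.erase y) Q c d :=
    ⟨hc, Finset.mem_erase.2 ⟨hyd.symm, hd⟩, hdom', hdom⟩
  have hcard : (P.erase y).card = p - 1 := by rw [Finset.card_erase_of_mem hy, hp]
  obtain ⟨f, hf1, hf2⟩ := (hD.exists_embedding (hT.erase_left hy hp') hG hcard hq).2 x hx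
    (by rintro rfl; exact hcy hyx.symm) ⟨0, by omega⟩
  rw [← hT.erase_union_left hy] at hf1
  obtain ⟨g, -, -⟩ := exists_embedding_attachPendants f (Sum.inr ⟨0, by omega⟩) (m := 1)
    (fun _ => y) (fun i j _ => Subsingleton.elim i j)
    (fun z _ => Finset.ne_of_mem_erase (hf1 z))
    (fun _ z => ⟨fun hadj => f.injective
      ((hp'.unique _ (Finset.mem_of_mem_erase (hf1 z)) hadj).trans hf2.symm),
      by rintro rfl; rw [hf2]; exact hyx⟩)
    (fun _ _ => G.irrefl)
  rw [treeB_of_three_le hp3 hpq]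
  refine nonempty_iso_of_card_eq g ?_
  rw [hn, Nat.card_eq_fintype_card]
  simp only [Fintype.card_sum, Fintype.card_fin]
  omega

theorem IsNearDoubleStar.nonempty_iso_two [Finite V] (hG : G.IsAcyclic) {P Q : Finset V}
    (hT : BiSubtree G P Q) (h : IsNearDoubleStar G Q P) {q : ℕ} (hP : P.card = 2)
    (hq : Q.card = q) (hn : Nat.card V = 2 + q) (hq2 : 2 ≤ q) :
    Nonempty (G ≃g (treeB 2 q).2) := by
  obtain ⟨d, hd, c, hc, y, hy, hdom, hcy, hdom'⟩ := h
  have hyd : y ≠ d := by rintro rfl; exact hcy (hdom c hc).symm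
  obtain ⟨b, hb, hbc⟩ := Finset.exists_mem_ne (by omega : 1 < P.card) c
  have hPe : P = {b, c} := (Finset.eq_of_subset_of_card_le
    (by simp [Finset.insert_subset_iff, hb, hc]) (by rw [Finset.card_pair hbc, hP])).symm
  obtain ⟨x, hx, hyx⟩ := hT.exists_adj ⟨c, hc⟩ hy
  have hyb : G.Adj y b := by
    rw [hPe, Finset.mem_insert, Finset.mem_singleton] at hx
    rcases hx with rfl | rfl
    · exact hyx
    · exact absurd hyx.symm hcy
  have hcd := hdom c hc
  have hdb := hdom b hb
  have hyc : y ≠ c := by rintro rfl; exact hT.notMem_left hy hc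
  have hdy := hT.indep_right d hd y hy
  have hcb := hT.indep_left c hc b hb
  obtain ⟨f, hf0, hf1, hf2, hf3⟩ : ∃ f : SimpleGraph.pathGraph 4 ↪g G,
      f 0 = c ∧ f 1 = d ∧ f 2 = b ∧ f 3 = y := by
    have key : ∀ i j, G.Adj (![c, d, b, y] i) (![c, d, b, y] j) ↔
        (SimpleGraph.pathGraph 4).Adj i j := by
      intro i j
      have h1 := hcd.symm; have h2 := hdb.symm; have h3 := hyb.symm
      have h4 : ¬ G.Adj y c := fun h => hcy h.symm
      have h5 : ¬ G.Adj y d := fun h => hdy h.symm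
      have h6 : ¬ G.Adj b c := fun h => hcb h.symm
      rw [SimpleGraph.pathGraph_adj]
      fin_cases i <;> fin_cases j <;>
        simp [h1, h2, h3, h4, h5, h6, hcd, hdb, hyb, hcy, hdy, hcb]
    refine ⟨⟨⟨![c, d, b, y], ?_⟩, fun {i j} => key i j⟩, rfl, rfl, rfl, rfl⟩
    have h1 := hcd.ne; have h2 := hdb.ne; have h3 := hyb.ne
    intro i j hij
    fin_cases i <;> fin_cases j <;> simp_all
  have hcard : ((Q.erase y).erase d).card = q - 2 := by
    rw [Finset.card_erase_of_mem (Finset.mem_erase.2 ⟨hyd.symm, hd⟩), Finset.card_erase_of_mem hy,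
      hq]
    omega
  obtain ⟨e, he, heQ⟩ := exists_enumeration hcard
  have heQ' : ∀ i, e i ∈ Q := fun i => Finset.mem_of_mem_erase (Finset.mem_of_mem_erase (heQ i))
  have hed : ∀ i, e i ≠ d := fun i => Finset.ne_of_mem_erase (heQ i)
  have hey : ∀ i, e i ≠ y := fun i => Finset.ne_of_mem_erase (Finset.mem_of_mem_erase (heQ i))
  have hec : ∀ i, G.Adj c (e i) := fun i => hdom' _ (Finset.mem_of_mem_erase (heQ i))
  have hne : ∀ x i, f x ≠ e i := by
    intro x i
    fin_cases x
    · exact hf0 ▸ (hec i).ne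
    · exact hf1 ▸ (hed i).symm
    · exact hf2 ▸ fun h => hT.notMem_left (heQ' i) (h ▸ hb)
    · exact hf3 ▸ (hey i).symm
  have hadj : ∀ i x, G.Adj (e i) (f x) ↔ x = 0 := by
    intro i x
    fin_cases x
    · exact iff_of_true (hf0 ▸ (hec i).symm) rfl
    · exact iff_of_false (hf1 ▸ hT.indep_right _ (heQ' i) _ hd) (by decide)
    · refine iff_of_false (fun h => ?_) (by decide)
      replace h : G.Adj (e i) b := hf2 ▸ h
      exact hbc (hG.eq_of_common_adj (hed i) h hdb.symm (hec i).symm hcd.symm)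
    · exact iff_of_false (hf3 ▸ hT.indep_right _ (heQ' i) _ hy) (by decide)
  obtain ⟨g, -, -⟩ := exists_embedding_attachPendants f 0 e he hne hadj
    fun i j => hT.indep_right _ (heQ' i) _ (heQ' j)
  rw [treeB_two]
  refine nonempty_iso_of_card_eq g ?_
  rw [hn, Nat.card_eq_fintype_card]
  simp only [Fintype.card_sum, Fintype.card_fin]
  omega

/-- A tree attaining the lower bound `le_count_of_leaves` is a path with pendant vertices at its
ends. -/
theorem nonempty_iso_pathWithPendants [Finite V] {k a b : ℕ}
    (f : SimpleGraph.pathGraph (k - 1 + 1) ↪g G) {K : Finset V}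
    (hIK : Disjoint (Finset.univ.image f) K)
    (hK : ∀ v ∈ K, ∃ u ∈ Finset.univ.image f, PendantAt G (Finset.univ.image f ∪ K) v u)
    (hKc : K.card = a + b) (hE : EndWeights f (fun x => (K.filter (G.Adj x)).card) a b)
    (hn : Nat.card V = k - 1 + 1 + (a + b)) : Nonempty (G ≃g pathWithPendants k a b) := by
  have hind : ∀ v ∈ K, ∀ v' ∈ K, ¬ G.Adj v v' := by
    intro v hv v' hv' hadj
    obtain ⟨u, hu, hp⟩ := hK v hv
    exact Finset.disjoint_left.1 hIK hu
      (hp.unique v' (Finset.mem_union_right _ hv') hadj ▸ hv')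
  have huniq : ∀ v ∈ K, ∀ i j, G.Adj v (f i) → G.Adj v (f j) → i = j := by
    intro v hv i j hi hj
    obtain ⟨u, hu, hp⟩ := hK v hv
    exact f.injective ((hp.unique _ (by simp) hi).trans (hp.unique _ (by simp) hj).symm)
  have hfK : ∀ i, f i ∉ K := fun i =>
    Finset.disjoint_left.1 hIK (Finset.mem_image_of_mem f (Finset.mem_univ i))
  -- after a reversal of the path, `K` splits into `a` leaves at its first vertex and `b` leaves at
  -- its last one
  obtain ⟨g, hgK, K₀, K₁, hK₀, hK₁, h0, h1, hdis, hadj0, hadj1⟩ :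
      ∃ g : SimpleGraph.pathGraph (k - 1 + 1) ↪g G, (∀ i, g i ∉ K) ∧ ∃ K₀ K₁ : Finset V,
        K₀ ⊆ K ∧ K₁ ⊆ K ∧ K₀.card = a ∧ K₁.card = b ∧ Disjoint K₀ K₁ ∧
        (∀ v ∈ K₀, ∀ i, G.Adj v (g i) ↔ i = 0) ∧
        (∀ v ∈ K₁, ∀ i, G.Adj v (g i) ↔ i = Fin.last (k - 1)) := by
    rcases Nat.eq_zero_or_pos (k - 1) with hk | hk
    · obtain ⟨K₀, hK₀, hc⟩ := Finset.exists_subset_card_eq (s := K) (n := a) (by omega)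
      have hsub : ∀ i j : Fin (k - 1 + 1), i = j := fun i j => Fin.ext (by omega)
      have hadj : ∀ v ∈ K, ∀ i, G.Adj v (f i) := by
        intro v hv i
        obtain ⟨u, hu, hp⟩ := hK v hv
        obtain ⟨j, -, rfl⟩ := Finset.mem_image.1 hu
        exact hsub j i ▸ hp.adj
      refine ⟨f, hfK, K₀, K \ K₀, hK₀, Finset.sdiff_subset, hc, ?_, Finset.disjoint_sdiff, ?_, ?_⟩
      · rw [Finset.card_sdiff_of_subset hK₀]; omega
      · exact fun v hv i => iff_of_true (hadj v (hK₀ hv) i) (hsub _ _)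
      · exact fun v hv i => iff_of_true (hadj v (Finset.sdiff_subset hv) i) (hsub _ _)
    · have h0l : (0 : Fin (k - 1 + 1)) ≠ Fin.last (k - 1) := by
        rw [Ne, Fin.ext_iff]; simp; omega
      have main : ∀ i₀ i₁ : Fin (k - 1 + 1), i₀ ≠ i₁ →
          (∀ v ∈ K.filter (G.Adj (f i₀)), ∀ i, G.Adj v (f i) ↔ i = i₀) ∧
          Disjoint (K.filter (G.Adj (f i₀))) (K.filter (G.Adj (f i₁))) := by
        intro i₀ i₁ hne
        refine ⟨fun v hv i => ?_, ?_⟩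
        · obtain ⟨hvK, hadj⟩ := Finset.mem_filter.1 hv
          exact ⟨fun h => huniq v hvK i i₀ h hadj.symm, by rintro rfl; exact hadj.symm⟩
        · rw [Finset.disjoint_left]
          intro v hv hv'
          obtain ⟨hvK, hadj⟩ := Finset.mem_filter.1 hv
          exact hne (huniq v hvK _ _ hadj.symm (Finset.mem_filter.1 hv').2.symm)
      rcases (hE hk).2 with ⟨h1, h2⟩ | ⟨h1, h2⟩
      · exact ⟨f, hfK, K.filter (G.Adj (f 0)), K.filter (G.Adj (f (Fin.last (k - 1)))),
          Finset.filter_subset _ _, Finset.filter_subset _ _, h1, h2, (main _ _ h0l).2,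
          (main _ _ h0l).1, (main _ _ h0l.symm).1⟩
      · obtain ⟨g, hg⟩ := exists_pathGraph_rev f
        refine ⟨g, fun i => hg i ▸ hfK _, K.filter (G.Adj (f (Fin.last (k - 1)))),
          K.filter (G.Adj (f 0)), Finset.filter_subset _ _, Finset.filter_subset _ _, h2, h1,
          (main _ _ h0l.symm).2, fun v hv i => ?_, fun v hv i => ?_⟩
        · rw [hg, (main _ _ h0l.symm).1 v hv, Fin.rev_eq_iff, Fin.rev_last]
        · rw [hg, (main _ _ h0l).1 v hv, Fin.rev_eq_iff, Fin.rev_zero]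
  obtain ⟨e₀, he₀, heK₀⟩ := exists_enumeration h0
  obtain ⟨e₁, he₁, heK₁⟩ := exists_enumeration h1
  obtain ⟨g', hg'1, hg'2⟩ := exists_embedding_attachPendants g 0 e₀ he₀
    (fun x i h => hgK x (h ▸ hK₀ (heK₀ i))) (fun i x => hadj0 _ (heK₀ i) x)
    (fun i j => hind _ (hK₀ (heK₀ i)) _ (hK₀ (heK₀ j)))
  obtain ⟨g'', -, -⟩ := exists_embedding_attachPendants g' (Sum.inl (Fin.last (k - 1))) e₁ he₁
    (by
      rintro (x | i) j h
      · rw [hg'1] at h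
        exact hgK x (h ▸ hK₁ (heK₁ j))
      · rw [hg'2] at h
        exact Finset.disjoint_left.1 hdis (heK₀ i) (h ▸ heK₁ j))
    (by
      rintro j (x | i)
      · rw [hg'1, hadj1 _ (heK₁ j), Sum.inl.injEq]
      · rw [hg'2]
        exact iff_of_false (hind _ (hK₁ (heK₁ j)) _ (hK₀ (heK₀ i))) (by simp))
    (fun i j => hind _ (hK₁ (heK₁ i)) _ (hK₁ (heK₁ j)))
  refine nonempty_iso_of_card_eq g'' ?_
  rw [hn, Nat.card_eq_fintype_card]
  simp only [Fintype.card_sum, Fintype.card_fin]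
  omega

/-! ### Subtree numbers of the extremal trees -/

/-- The value `2 ^ (p + q - 2) + 2 ^ (p - 1) + 2 ^ (q - 1) + p + q - 2`, multiplied by four to avoid
truncated subtractions. -/
theorem subtreeCount_doubleStar {p q : ℕ} (hp : 1 ≤ p) (hq : 1 ≤ q) :
    4 * subtreeCount (doubleStar p q) + 8 =
      2 ^ (p + q) + 2 * 2 ^ p + 2 * 2 ^ q + 4 * (p + q) := by
  have hT := treeWithClasses_doubleStar hp q
  obtain ⟨P, Q, hB, hU, hP, hQ, hmP, hmQ⟩ := hT.exists_biSubtree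
  rw [Set.ncard_image_of_injective _ Sum.inl_injective, ncard_compl_zero] at hP
  rw [ncard_inl_union_inr, Set.ncard_singleton] at hQ
  have hlast : Fin.last p ≠ 0 := by rw [Ne, Fin.ext_iff]; simp; omega
  have hD : DoubleStarAt (doubleStar p q) P Q (Sum.inl 0) (Sum.inl (Fin.last p)) := by
    refine ⟨(hmQ _).2 (Or.inl ⟨0, rfl, rfl⟩), (hmP _).2 ⟨_, hlast, rfl⟩, ?_, ?_⟩
    · intro x hx
      obtain ⟨i, hi, rfl⟩ := (hmP x).1 hx
      exact SimpleGraph.starGraph_adj.2 ⟨Ne.symm hi, Or.inl rfl⟩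
    · intro x hx
      rcases (hmQ x).1 hx with ⟨i, rfl, rfl⟩ | ⟨i, rfl⟩
      · exact SimpleGraph.starGraph_adj.2 ⟨hlast, Or.inr rfl⟩
      · rfl
  obtain ⟨-, -, -, h⟩ := hD.count_eq hT.isTree.isAcyclic hB
  rw [hU, hP, hQ, Nat.add_sub_cancel' hq, ← subtreeCount_eq] at h
  exact h

theorem isBipartitionTree_treeB_of_three_le {n p q : ℕ} (hp : 3 ≤ p) (hpq : p ≤ q)
    (hn : p + q = n) : IsBipartitionTree n p q (treeB p q).2 ∧
      16 * subtreeCount (treeB p q).2 + 16 =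
        3 * 2 ^ (p + q) + 12 * 2 ^ q + 4 * 2 ^ p + 16 * (p + q) := by
  rw [treeB_of_three_le hp hpq]
  have hT := treeWithClasses_attach_doubleStar hp (show 0 < q - 1 by omega)
  have c1 : (Sum.inl '' (Sum.inl '' {0}ᶜ) ∪ Set.range Sum.inr :
      Set ((Fin (p - 1 + 1) ⊕ Fin (q - 1)) ⊕ Fin 1)).ncard = p := by
    rw [ncard_inl_union_inr, Set.ncard_image_of_injective _ Sum.inl_injective, ncard_compl_zero]
    omega
  have c2 : (Sum.inl '' (Sum.inl '' {0} ∪ Set.range Sum.inr) :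
      Set ((Fin (p - 1 + 1) ⊕ Fin (q - 1)) ⊕ Fin 1)).ncard = q := by
    rw [Set.ncard_image_of_injective _ Sum.inl_injective, ncard_inl_union_inr, Set.ncard_singleton]
    omega
  refine ⟨hT.isBipartitionTree c1 c2 hn, ?_⟩
  obtain ⟨P, Q, hB, hU, hP, hQ, hmP, hmQ⟩ := hT.exists_biSubtree
  have hlast : Fin.last (p - 1) ≠ 0 := by rw [Ne, Fin.ext_iff]; simp; omega
  have hN : IsNearDoubleStar (attachPendants (doubleStar (p - 1) q)
      (Sum.inr ⟨0, show 0 < q - 1 by omega⟩) 1) P Q := by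
    refine .of_forall_ne (d := Sum.inl (Sum.inl (Fin.last _))) (c := Sum.inl (Sum.inl 0))
      (y := Sum.inr 0) ((hmP _).2 (Or.inl ⟨_, ⟨_, hlast, rfl⟩, rfl⟩))
      ((hmQ _).2 ⟨_, Or.inl ⟨0, rfl, rfl⟩, rfl⟩) ((hmP _).2 (Or.inr ⟨0, rfl⟩)) ?_
      (fun h => Sum.inl_ne_inr h) ?_
    · intro x hx
      obtain ⟨y, ⟨i, rfl, rfl⟩ | ⟨i, rfl⟩, rfl⟩ := (hmQ x).1 hx
      · exact SimpleGraph.starGraph_adj.2 ⟨hlast, Or.inr rfl⟩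
      · rfl
    · intro x hx hxy
      rcases (hmP x).1 hx with ⟨_, ⟨i, hi, rfl⟩, rfl⟩ | ⟨i, rfl⟩
      · exact SimpleGraph.starGraph_adj.2 ⟨Ne.symm hi, Or.inl rfl⟩
      · exact absurd (congrArg Sum.inr (Subsingleton.elim i 0)) hxy
  have h := hN.count_eq hT.isTree.isAcyclic hB
  rw [hU, hP, hQ, c1, c2, ← subtreeCount_eq] at h
  exact h

theorem isBipartitionTree_treeB_two {q : ℕ} (hq : 2 ≤ q) :
    IsBipartitionTree (2 + q) 2 q (treeB 2 q).2 ∧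
      4 * subtreeCount (treeB 2 q).2 = 2 ^ (2 + q) + 4 * (2 + q) + 8 := by
  rw [treeB_two]
  have hpath : TreeWithClasses (SimpleGraph.pathGraph 4) {0, 2} {1, 3} := by
    refine ⟨isTree_pathGraph 3, ?_, ?_, ?_⟩
    · ext x; fin_cases x <;> simp
    · rw [Set.disjoint_left]
      intro x; fin_cases x <;> simp
    · intro x y h
      rw [SimpleGraph.pathGraph_adj] at h
      fin_cases x <;> fin_cases y <;> simp at h ⊢
  have hT := hpath.attachPendants (v := 0) (by simp) (q - 2)
  have c1 : (Sum.inl '' {0, 2} : Set (Fin 4 ⊕ Fin (q - 2))).ncard = 2 := by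
    rw [Set.ncard_image_of_injective _ Sum.inl_injective, Set.ncard_pair (by decide)]
  have c2 : (Sum.inl '' {1, 3} ∪ Set.range Sum.inr : Set (Fin 4 ⊕ Fin (q - 2))).ncard = q := by
    rw [ncard_inl_union_inr, Set.ncard_pair (by decide)]
    omega
  refine ⟨hT.isBipartitionTree c1 c2 rfl, ?_⟩
  obtain ⟨Q, P, hB, hU, hQ, hP, hmQ, hmP⟩ := hT.symm.exists_biSubtree
  have hadj : ∀ i j : Fin 4, (i.val + 1 = j.val ∨ j.val + 1 = i.val) →
      (attachPendants (SimpleGraph.pathGraph 4) 0 (q - 2)).Adj (Sum.inl i) (Sum.inl j) :=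
    fun i j h => SimpleGraph.pathGraph_adj.2 h
  have hN : IsNearDoubleStar (attachPendants (SimpleGraph.pathGraph 4) 0 (q - 2)) Q P := by
    refine .of_forall_ne (d := Sum.inl 1) (c := Sum.inl 0) (y := Sum.inl 3)
      ((hmQ _).2 (Or.inl ⟨1, by simp, rfl⟩)) ((hmP _).2 ⟨0, by simp, rfl⟩)
      ((hmQ _).2 (Or.inl ⟨3, by simp, rfl⟩)) ?_ ?_ ?_
    · intro x hx
      obtain ⟨i, rfl | rfl, rfl⟩ := (hmP x).1 hx
      · exact hadj _ _ (by decide)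
      · exact hadj _ _ (by decide)
    · intro h
      exact absurd (SimpleGraph.pathGraph_adj.1 h) (by decide)
    · intro x hx hxy
      rcases (hmQ x).1 hx with ⟨i, rfl | rfl, rfl⟩ | ⟨i, rfl⟩
      · exact hadj _ _ (by decide)
      · exact absurd rfl hxy
      · rfl
  have h := hN.count_eq hT.isTree.isAcyclic hB
  rw [hU, hP, hQ, c1, c2, ← subtreeCount_eq] at h
  have e1 : 2 ^ (2 + q) = 4 * 2 ^ q := by rw [pow_add]; norm_num
  rw [add_comm q 2] at h
  change 4 * subtreeCount (attachPendants (SimpleGraph.pathGraph 4) 0 (q - 2)) = _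
  omega

theorem subtreeCount_pathWithPendants (k a b : ℕ) :
    subtreeCount (pathWithPendants k a b) =
      (k - 1) * (2 ^ a + 2 ^ b) + (k - 1).choose 2 + 2 ^ (a + b) + (a + b) := by
  obtain ⟨f, hf⟩ : ∃ f : SimpleGraph.pathGraph (k - 1 + 1) ↪g pathWithPendants k a b,
      ∀ i, f i = Sum.inl (Sum.inl i) :=
    ⟨⟨⟨fun i => Sum.inl (Sum.inl i), Sum.inl_injective.comp Sum.inl_injective⟩, Iff.rfl⟩,
      fun i => rfl⟩
  obtain ⟨e, he, he'⟩ : ∃ e : Fin a ⊕ Fin b ↪ (Fin (k - 1 + 1) ⊕ Fin a) ⊕ Fin b,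
      (∀ i, e (Sum.inl i) = Sum.inl (Sum.inr i)) ∧ ∀ i, e (Sum.inr i) = Sum.inr i :=
    ⟨⟨Sum.map Sum.inr id, Sum.inr_injective.sumMap Function.injective_id⟩,
      fun i => rfl, fun i => rfl⟩
  rw [subtreeCount_eq]
  refine count_path_with_leaves f e ?_ ?_ ?_ ?_
  · rintro ((x | x) | x)
    · exact Or.inl ⟨x, hf x⟩
    · exact Or.inr ⟨Sum.inl x, he x⟩
    · exact Or.inr ⟨Sum.inr x, he' x⟩
  · rintro i (j | j)
    · rw [hf, he]
      exact fun h => Sum.inl_ne_inr (Sum.inl_injective h)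
    · rw [hf, he']
      exact Sum.inl_ne_inr
  · intro i x
    rw [he, hf]
    obtain (x | x) | x := x <;> simp [pathWithPendants]
  · intro i x
    rw [he', hf]
    obtain x | x := x <;> simp [pathWithPendants]

/-! ### The extremal bounds -/

theorem BiSubtree.three_le_card_of_card_eq_two (hG : G.IsAcyclic) {P Q : Finset V}
    (hT : BiSubtree G P Q) (hP : P.card = 2) (hQ : 2 ≤ Q.card) (hD : ¬ IsDoubleStar G P Q) :
    3 ≤ Q.card := by
  by_contra hc
  have hPne : P.Nonempty := Finset.card_pos.1 (by omega)
  obtain ⟨v, hv, w, hw, hp⟩ := hT.exists_leaf hG hPne (by omega)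
  have h1 := Finset.card_erase_add_one hv
  have h2 : (Q.erase v).card = 1 := by omega
  obtain ⟨c, hc, hdom⟩ := (hT.erase hv hp).symm.dominates_of_card_eq_one h2
  refine hD ⟨c, w, Finset.mem_of_mem_erase hc, hw, hdom, fun x hx => ?_⟩
  by_cases hxv : x = v
  · exact hxv ▸ hp.adj.symm
  · obtain rfl : x = c := Finset.card_le_one.1 h2.le x (Finset.mem_erase.2 ⟨hxv, hx⟩) c hc
    exact (hdom w hw).symm

/-- The bound of the second largest subtree number, together with its equality case, for a tree
with classes of sizes `p ≤ q`. -/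
theorem subtreeCount_le_treeB {n p q : ℕ} (hp : 2 ≤ p) (hpq : p ≤ q) (hn : p + q = n)
    {T : SimpleGraph V} (hT : IsBipartitionTree n p q T) (hD : IsEmpty (T ≃g doubleStar p q)) :
    3 ≤ q ∧ subtreeCount T ≤ subtreeCount (treeB p q).2 ∧
      (subtreeCount T = subtreeCount (treeB p q).2 → Nonempty (T ≃g (treeB p q).2)) := by
  have hcard := hT.card_eq
  have : Finite V := Nat.finite_of_card_ne_zero (by omega)
  have := Fintype.ofFinite V
  obtain ⟨P, Q, hB, hU, hP, hQ⟩ := hT.exists_biSubtree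
  have hG := hT.isTree.isAcyclic
  have hcard' : Nat.card V = p + q := by omega
  have hnD : ¬ IsDoubleStar T P Q := by
    rintro ⟨c, d, h⟩
    exact not_isEmpty_iff.2 (h.nonempty_iso hG hB hP hQ hcard') hD
  rw [subtreeCount_eq T, ← hU]
  rcases hp.eq_or_lt with rfl | hp3
  · obtain ⟨h1, h2⟩ := count_le_of_card_eq_two hG hB hP (by omega) hnD
    obtain ⟨-, h3⟩ := isBipartitionTree_treeB_two hpq
    have h4 := hB.three_le_card_of_card_eq_two hG hP (by omega) hnD
    rw [hQ] at h1 h2 h4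
    refine ⟨h4, by omega, fun heq => ?_⟩
    exact (h2 (by omega)).nonempty_iso_two hG hB hP hQ hcard' hpq
  · obtain ⟨h1, h2⟩ := count_le_of_three_le_card hG hB (by omega) (by omega) hnD
    obtain ⟨-, h3⟩ := isBipartitionTree_treeB_of_three_le hp3 hpq hn
    rw [hP, hQ] at h1 h2
    refine ⟨by omega, by omega, fun heq => ?_⟩
    rcases h2 (by omega) with h | ⟨hpq', h⟩
    · exact h.nonempty_iso_of_three_le hG hB hP hQ hcard' hp3 hpq
    · exact h.nonempty_iso_of_three_le hG hB.symm (hQ.trans hpq'.symm) (hP.trans hpq')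
        hcard' hp3 hpq

theorem subtreeCount_treeB_lt {p q : ℕ} (hp : 2 ≤ p) (hpq : p ≤ q) (hq : 3 ≤ q) :
    subtreeCount (treeB p q).2 < subtreeCount (doubleStar p q) := by
  have hD := subtreeCount_doubleStar (p := p) (q := q) (by omega) (by omega)
  have e1 : 2 ^ q = 8 * 2 ^ (q - 3) := by
    rw [show (8 : ℕ) = 2 ^ 3 by norm_num, ← pow_add]; congr 1; omega
  have e2 : 0 < 2 ^ (q - 3) := by positivity
  rcases hp.eq_or_lt with rfl | hp3
  · obtain ⟨-, hB⟩ := isBipartitionTree_treeB_two hpq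
    omega
  · obtain ⟨-, hB⟩ := isBipartitionTree_treeB_of_three_le hp3 hpq rfl
    have e3 : 2 ^ (p + q) = 2 ^ p * 2 ^ q := pow_add _ _ _
    have e4 : 2 ^ p = 8 * 2 ^ (p - 3) := by
      rw [show (8 : ℕ) = 2 ^ 3 by norm_num, ← pow_add]; congr 1; omega
    have e5 : 0 < 2 ^ (p - 3) := by positivity
    have e6 : 8 * 2 ^ q ≤ 2 ^ p * 2 ^ q := Nat.mul_le_mul_right _ (by omega)
    omega

theorem subtreeCount_le_doubleStar {n p q : ℕ} (hp : 1 ≤ p) (hpq : p ≤ q) (hn : p + q = n)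
    {T : SimpleGraph V} (hT : IsBipartitionTree n p q T) :
    subtreeCount T ≤ subtreeCount (doubleStar p q) ∧
      (subtreeCount T = subtreeCount (doubleStar p q) → Nonempty (T ≃g doubleStar p q)) := by
  rcases isEmpty_or_nonempty (T ≃g doubleStar p q) with hD | hD
  · have hp2 : 2 ≤ p := by
      have hcard := hT.card_eq
      have : Finite V := Nat.finite_of_card_ne_zero (by omega)
      have := Fintype.ofFinite V
      obtain ⟨P, Q, hB, hU, hP, hQ⟩ := hT.exists_biSubtree
      rw [← hP]
      refine hB.two_le_card_left (Finset.card_pos.1 (by omega)) (Finset.card_pos.1 (by omega)) ?_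
      rintro ⟨c, d, h⟩
      exact not_isEmpty_iff.2
        (h.nonempty_iso hT.isTree.isAcyclic hB hP hQ (by omega)) hD
    obtain ⟨hq, h1, -⟩ := subtreeCount_le_treeB hp2 hpq hn hT hD
    have h2 := subtreeCount_treeB_lt hp2 hpq hq
    exact ⟨by omega, fun h => by omega⟩
  · exact ⟨(subtreeCount_congr hD.some).le, fun _ => hD⟩

/-- The class of size `q ≥ p` contains at least `q - p + 1` leaves; the lower bound comes from any
such set of leaves. -/
theorem pathWithPendants_le_subtreeCount {n p q a b : ℕ} (hp : 1 ≤ p) (hn : p + q = n)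
    (hab : a ≤ b) (hba : b ≤ a + 1) (hk : a + b + p = q + 1) {T : SimpleGraph V}
    (hT : IsBipartitionTree n p q T) :
    subtreeCount (pathWithPendants (2 * p - 1) a b) ≤ subtreeCount T ∧
      (subtreeCount T = subtreeCount (pathWithPendants (2 * p - 1) a b) →
        Nonempty (T ≃g pathWithPendants (2 * p - 1) a b)) := by
  have hcard := hT.card_eq
  have : Finite V := Nat.finite_of_card_ne_zero (by omega)
  have := Fintype.ofFinite V
  obtain ⟨P, Q, hB, hU, hP, hQ⟩ := hT.exists_biSubtree
  have hG := hT.isTree.isAcyclic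
  have hPne : P.Nonempty := Finset.card_pos.1 (by omega)
  obtain ⟨L, hLQ, hLc, hL⟩ := hB.exists_leaves hG hPne
  obtain ⟨K, hKL, hKc⟩ := Finset.exists_subset_card_eq (s := L) (n := a + b) (by omega)
  obtain ⟨I, hI⟩ : ∃ I : Finset V, I = Finset.univ \ K := ⟨_, rfl⟩
  have hIK : Disjoint I K := hI ▸ Finset.sdiff_disjoint
  have hIU : I ∪ K = Finset.univ := hI ▸ Finset.sdiff_union_of_subset (Finset.subset_univ K)
  have hK : ∀ v ∈ K, ∃ u ∈ I, PendantAt T (I ∪ K) v u := by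
    intro v hv
    obtain ⟨w, hw⟩ := hL v (hKL hv)
    refine ⟨w, ?_, by rwa [hIU, ← hU]⟩
    rw [hI, Finset.mem_sdiff]
    exact ⟨Finset.mem_univ w, fun hwK =>
      hB.notMem_left (hLQ (hKL hwK)) (hB.nbr_mem (hLQ (hKL hv)) hw)⟩
  have hIc : I.card = 2 * p - 1 - 1 + 1 := by
    rw [hI, Finset.card_sdiff_of_subset (Finset.subset_univ K), Finset.card_univ,
      ← Nat.card_eq_fintype_card]
    omega
  have hS : SpansSubtree T (I ∪ K) := by rw [hIU, ← hU]; exact hB.spans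
  obtain ⟨h1, h2⟩ := le_count_of_leaves hG hab hba hIK hK hS hIc hKc
  rw [hIU, ← subtreeCount_eq] at h1 h2
  rw [subtreeCount_pathWithPendants]
  refine ⟨h1, fun heq => ?_⟩
  obtain ⟨f, rfl, hE⟩ := h2 heq
  exact nonempty_iso_pathWithPendants f hIK hK hKc hE (by omega)

theorem floor_half (k : ℕ) : ⌊(k : ℚ) / 2⌋₊ = k / 2 := by
  exact_mod_cast Nat.floor_div_eq_div (K := ℚ) k 2

theorem ceil_half (k : ℕ) : ⌈(k : ℚ) / 2⌉₊ = (k + 1) / 2 := by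
  obtain ⟨j, rfl | rfl⟩ := Nat.even_or_odd' k
  · have h : ((2 * j : ℕ) : ℚ) / 2 = (j : ℕ) := by push_cast; ring
    rw [h, Nat.ceil_natCast]
    omega
  · have h : (2 * j + 1 + 1) / 2 = j + 1 := by omega
    rw [h, Nat.ceil_eq_iff (by omega)]
    constructor <;> push_cast <;> linarith

end

theorem theorem1p3 (n p q : ℕ) (hp : 1 ≤ p) (hpq : p ≤ q) (hn : p + q = n) :
    -- (i) the double star is the unique maximizer
    (IsBipartitionTree n p q (doubleStar p q) ∧
      subtreeCount (doubleStar p q) = 2 ^ (n - 2) + 2 ^ (p - 1) + 2 ^ (q - 1) + (n - 2) ∧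
      ∀ (V : Type*) (T : SimpleGraph V), IsBipartitionTree n p q T →
        subtreeCount T ≤ subtreeCount (doubleStar p q) ∧
        (subtreeCount T = subtreeCount (doubleStar p q) ↔ Nonempty (T ≃g doubleStar p q))) ∧
    -- (ii) `B(p, q)` is the unique maximizer among the trees other than the double star
    (2 ≤ p →
      IsBipartitionTree n p q (treeB p q).2 ∧
      (3 ≤ q → IsEmpty ((treeB p q).2 ≃g doubleStar p q)) ∧
      subtreeCount (treeB p q).2 =
        (if 2 < p then 3 * 2 ^ (n - 4) + 3 * 2 ^ (q - 2) + 2 ^ (p - 2) + (n - 1)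
          else 2 ^ (n - 2) + n + 2) ∧
      ∀ (V : Type*) (T : SimpleGraph V), IsBipartitionTree n p q T →
        IsEmpty (T ≃g doubleStar p q) →
        subtreeCount T ≤ subtreeCount (treeB p q).2 ∧
        (subtreeCount T = subtreeCount (treeB p q).2 ↔ Nonempty (T ≃g (treeB p q).2))) ∧
    -- (iii) `P_{2p-1}(⌊(n-2p+1)/2⌋, ⌈(n-2p+1)/2⌉)` is the unique minimizer
    (∀ k a b : ℕ, k = n - 2 * p + 1 → a = ⌊(k : ℚ) / 2⌋₊ → b = ⌈(k : ℚ) / 2⌉₊ →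
      IsBipartitionTree n p q (pathWithPendants (2 * p - 1) a b) ∧
      subtreeCount (pathWithPendants (2 * p - 1) a b) =
        (2 * p - 2) * (2 ^ a + 2 ^ b) + (2 * p - 2).choose 2 + 2 ^ k + k ∧
      ∀ (V : Type*) (T : SimpleGraph V), IsBipartitionTree n p q T →
        subtreeCount (pathWithPendants (2 * p - 1) a b) ≤ subtreeCount T ∧
        (subtreeCount T = subtreeCount (pathWithPendants (2 * p - 1) a b) ↔
          Nonempty (T ≃g pathWithPendants (2 * p - 1) a b))) := by
  have pow_split : ∀ i j : ℕ, j ≤ i → 2 ^ i = 2 ^ j * 2 ^ (i - j) := fun i j h => by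
    rw [← pow_add, Nat.add_sub_cancel' h]
  refine ⟨⟨isBipartitionTree_doubleStar hp (by omega) hn, ?_, fun V T hT => ?_⟩,
    fun hp2 => ⟨?_, fun hq => ⟨fun e => ?_⟩, ?_, fun V T hT hD => ?_⟩, ?_⟩
  · have h := subtreeCount_doubleStar hp (hp.trans hpq)
    have e1 := pow_split p 1 hp
    have e2 := pow_split q 1 (by omega)
    have e3 := pow_split (p + q) 2 (by omega)
    rw [hn] at h e3
    omega
  · obtain ⟨h1, h2⟩ := subtreeCount_le_doubleStar hp hpq hn hT
    exact ⟨h1, h2, fun ⟨e⟩ => subtreeCount_congr e⟩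
  · rcases hp2.eq_or_lt with rfl | hp3
    · exact hn ▸ (isBipartitionTree_treeB_two hpq).1
    · exact (isBipartitionTree_treeB_of_three_le hp3 hpq hn).1
  · exact (subtreeCount_treeB_lt hp2 hpq hq).ne (subtreeCount_congr e)
  · rcases hp2.eq_or_lt with rfl | hp3
    · have h := (isBipartitionTree_treeB_two hpq).2
      have e1 := pow_split (2 + q) 2 (by omega)
      rw [hn] at h e1
      rw [if_neg (by omega)]
      omega
    · have h := (isBipartitionTree_treeB_of_three_le hp3 hpq hn).2
      have e1 := pow_split p 2 (by omega)
      have e2 := pow_split q 2 (by omega)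
      have e3 := pow_split (p + q) 4 (by omega)
      rw [hn] at h e3
      rw [if_pos hp3]
      omega
  · obtain ⟨-, h1, h2⟩ := subtreeCount_le_treeB hp2 hpq hn hT hD
    exact ⟨h1, h2, fun ⟨e⟩ => subtreeCount_congr e⟩
  · intro k a b hk ha hb
    rw [floor_half] at ha
    rw [ceil_half] at hb
    have hab : a + b = k := by omega
    refine ⟨isBipartitionTree_pathWithPendants hp hn (by omega), ?_, fun V T hT => ?_⟩
    · rw [subtreeCount_pathWithPendants, hab, Nat.sub_sub]
    · obtain ⟨h1, h2⟩ := pathWithPendants_le_subtreeCount (a := a) (b := b) hp hn (by omega)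
        (by omega) (by omega) hT
      exact ⟨h1, h2, fun ⟨e⟩ => subtreeCount_congr e⟩
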